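/- Let $\mathbb{D}=\{z\in\mathbb{C}:|z|<1\}$. For $\beta>0$ let $\mathcal{G}(\beta)$ be the class of analytic functions $f$ on $\mathbb{D}$ with $f(0)=0$, $f'(0)=1$, $f'\neq 0$ on $\mathbb{D}$ and $$\operatorname{Re}\left(1+\frac{zf''(z)}{f'(z)}\right)<1+\frac{\beta}{2}\qquad(z\in\mathbb{D}).$$ For $z_1,z_2\in\mathbb{D}$ put $$\lambda(z_1,z_2)=\frac12\log\frac{1+\rho(z_1,z_2)}{1-\rho(z_1,z_2)},\qquad \rho(z_1,z_2)=\left|\frac{z_1-z_2}{1-\overline{z_1}z_2}\right|,$$ and, for $f\in\mathcal{G}(\beta)$, $$\Delta_f(z_1,z_2)=\frac{|f(z_1)-f(z_2)|}{\sqrt{(1-|z_1|^2)|f'(z_1)|\,(1-|z_2|^2)|f'(z_2)|}}.$$ Let $\beta>\sqrt2-1$ and $\delta_\beta=\sqrt{\beta^2+2\beta-1}$. Then for every $f\in\mathcal{G}(\beta)$ $$\Delta_f(z_1,z_2)\ \ge\ \frac{1}{\delta_\beta}\sin\bigl(\delta_\beta\,\lambda(z_1,z_2)\bigr)\quad\text{for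 all } z_1,z_2\in\mathbb{D}\text{ with }\lambda(z_1,z_2)\le \frac{\pi}{\delta_\beta},$$ $$\Delta_f(z_1,z_2)\ \le\ \frac{1}{1+\beta}\sinh\bigl((1+\beta)\,\lambda(z_1,z_2)\bigr)\quad\text{for all } z_1,z_2\in\mathbb{D}.$$ Both inequalities are sharp, in the following sense. There is a function $f\in\mathcal{G}(\beta)$ such that: 1. for every $0<\delta<\delta_\beta$ there are $z_1,z_2\in\mathbb{D}$ with $\lambda(z_1,z_2)\le\pi/\delta_\beta$ and $\Delta_f(z_1,z_2)<\frac1\delta\sin(\delta\,\lambda(z_1,z_2))$; 2. for every $0<c<1+\beta$ there are $z_1,z_2\in\mathbb{D}$ with $\Delta_f(z_1,z_2)>\frac1c\sinh(c\,\lambda(z_1,z_2))$; moreover, for all $\ell>0$ and $\varepsilon>0$ there are $z_1,z_2\in\mathbb{D}$ with $\lambda(z_1,z_2)=\ell$ and $\Delta_f(z_1,z_2)>\frac{1}{1+\beta}\sinh((1+\beta)\ell)-\varepsilon$. -/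

import Mathlib

/-- The class `𝒢(β)`: analytic functions `f` on the open unit disk with `f 0 = 0`, `f' 0 = 1` and
`Re (1 + z f''(z) / f'(z)) < 1 + β / 2` on the disk. The quotient has to make sense,
so `f'` has no zero in the disk. -/
structure IsClassG (β : ℝ) (f : ℂ → ℂ) : Prop where
  analytic : DifferentiableOn ℂ f (Metric.ball 0 1)
  map_zero : f 0 = 0
  deriv_zero : deriv f 0 = 1
  deriv_ne_zero : ∀ z ∈ Metric.ball (0 : ℂ) 1, deriv f z ≠ 0
  re_lt : ∀ z ∈ Metric.ball (0 : ℂ) 1,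
    (1 + z * deriv (deriv f) z / deriv f z).re < 1 + β / 2

/-- The pseudo-hyperbolic distance `ρ` on the unit disk. -/
noncomputable def pseudoHypDist (z₁ z₂ : ℂ) : ℝ :=
  ‖(z₁ - z₂) / (1 - (starRingEnd ℂ) z₁ * z₂)‖

/-- The hyperbolic distance `λ` on the unit disk. -/
noncomputable def hypDist (z₁ z₂ : ℂ) : ℝ :=
  (1 / 2) * Real.log ((1 + pseudoHypDist z₁ z₂) / (1 - pseudoHypDist z₁ z₂))

/-- The two-point distortion quantity
`Δ_f(z₁, z₂) = |f(z₁) - f(z₂)| / √((1 - |z₁|²)|f'(z₁)| (1 - |z₂|²)|f'(z₂)|)`. -/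
noncomputable def twoPointDistortion (f : ℂ → ℂ) (z₁ z₂ : ℂ) : ℝ :=
  ‖f z₁ - f z₂‖ /
    Real.sqrt (((1 - ‖z₁‖ ^ 2) * ‖deriv f z₁‖) * ((1 - ‖z₂‖ ^ 2) * ‖deriv f z₂‖))

open Set Filter Topology Metric

/-! Write `T = f''/f'` and `h = (f')^(-1/2)`. Along the unit speed hyperbolic geodesic `γ` from `z₁`
to `z₂`, the function `f ∘ γ - f z₁` times `h ∘ γ` and the denominator of `γ` solves `v'' = q v`,
and `‖v‖` is `‖v' 0‖` times the distortion. Here `q = 1 - (S/2) γ'^2`, with `S/2 = T'/2 - T²/4` half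
the Schwarzian and `|γ'| = 1 - |γ|²` (`IsClassG.exists_solution`).

The class enters only through `(1 - |z|²)² |S/2| ≤ β² + 2β` (`norm_schwarzian_le`). The half-plane
condition on `z T` reads `T = -βφ/(1 - zφ)` with `|φ| ≤ 1`, and Schwarz–Pick controls `φ'`. Hence
`Re q ≥ -δ_β²` and `|q| ≤ (1 + β)²`, and comparison with constant coefficients gives the two bounds.

For sharpness take `f' = (1 - z)^β`. Blowing up at the boundary point `1` turns the disk into the
right half-plane and `f`, up to affine maps, into `w^(1 + β)`. Pairs on the real axis then realise
the `sinh` bound in the limit. Conjugate pairs give a profile agreeing with `sin (δ_β t)/δ_β` to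
third order at `0`, which rules out every smaller `δ`. -/

/-! ### Comparison theorems for `v'' = q v` -/

/-- Comparison for `v'' = q v` with `‖q‖ ≤ k²`: the solution grows at most like `sinh (k t) / k`. -/
theorem norm_le_sinh_of_hasDerivAt {v v' q : ℝ → ℂ} {k : ℝ} (hk : 0 < k)
    (hv : ∀ t, HasDerivAt v (v' t) t) (hv' : ∀ t, HasDerivAt v' (q t * v t) t)
    (hq : ∀ t, ‖q t‖ ≤ k ^ 2) (h0 : v 0 = 0) {t : ℝ} (ht : 0 ≤ t) :
    ‖v t‖ ≤ ‖v' 0‖ * (Real.sinh (k * t) / k) := by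
  have hvc : Continuous v := continuous_iff_continuousAt.2 fun t => (hv t).continuousAt
  have hvc' : Continuous v' := continuous_iff_continuousAt.2 fun t => (hv' t).continuousAt
  set A := ‖v' 0‖ with hA
  -- `B` and `J` majorise `‖v'‖` and `‖v‖`. Unlike the norms they are differentiable everywhere, and
  -- `J'' = k² ‖v‖ ≤ k² J`.
  set B : ℝ → ℝ := fun t => A + k ^ 2 * ∫ x in (0 : ℝ)..t, ‖v x‖ with hB
  have hBd : ∀ t, HasDerivAt B (k ^ 2 * ‖v t‖) t := fun t =>
    ((intervalIntegral.integral_hasDerivAt_right (hvc.norm.intervalIntegrable _ _)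
      (hvc.norm.stronglyMeasurableAtFilter _ _) hvc.norm.continuousAt).const_mul (k ^ 2)).const_add A
  have hBc : Continuous B := continuous_iff_continuousAt.2 fun t => (hBd t).continuousAt
  set J : ℝ → ℝ := fun t => ∫ x in (0 : ℝ)..t, B x with hJ
  have hJd : ∀ t, HasDerivAt J (B t) t := fun t =>
    intervalIntegral.integral_hasDerivAt_right (hBc.intervalIntegrable _ _)
      (hBc.stronglyMeasurableAtFilter _ _) hBc.continuousAt
  have hv'B : ∀ t, 0 ≤ t → ‖v' t‖ ≤ B t := fun t ht =>
    image_norm_le_of_norm_deriv_right_le_deriv_boundary (a := 0) (b := t) hvc'.continuousOn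
      (fun x _ => (hv' x).hasDerivWithinAt) (by simp [hB, hA]) hBd
      (fun x _ => by rw [norm_mul]; gcongr; exact hq x) ⟨ht, le_rfl⟩
  have hvJ : ∀ t, 0 ≤ t → ‖v t‖ ≤ J t := fun t ht =>
    image_norm_le_of_norm_deriv_right_le_deriv_boundary (a := 0) (b := t) hvc.continuousOn
      (fun x _ => (hv x).hasDerivWithinAt) (by simp [hJ, h0]) hJd
      (fun x hx => hv'B x hx.1) ⟨ht, le_rfl⟩
  have hexp : ∀ c t : ℝ, HasDerivAt (fun t => Real.exp (c * t)) (Real.exp (c * t) * c) t :=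
    fun c t => by simpa using ((hasDerivAt_id t).const_mul c).exp
  have hB0 : B 0 = A := by simp [hB]
  have hJ0 : J 0 = 0 := by simp [hJ]
  -- Factor `J'' - k² J` as `(d/dt + k)(d/dt - k) J` and integrate one factor at a time, with
  -- integrating factors `exp (k t)` and then `exp (-k t)`.
  have first : ∀ t, 0 ≤ t → Real.exp (k * t) * (B t - k * J t) ≤ A := by
    intro t ht
    have hd : ∀ t, HasDerivAt (fun t => Real.exp (k * t) * (B t - k * J t))
        (Real.exp (k * t) * k * (B t - k * J t) +
          Real.exp (k * t) * (k ^ 2 * ‖v t‖ - k * B t)) t :=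
      fun t => (hexp k t).mul ((hBd t).sub ((hJd t).const_mul k))
    have anti := antitoneOn_of_hasDerivWithinAt_nonpos (convex_Ici (0 : ℝ))
      (fun t _ => (hd t).continuousAt.continuousWithinAt) (fun t _ => (hd t).hasDerivWithinAt)
      (fun t ht => by
        rw [interior_Ici] at ht
        have := hvJ t (le_of_lt ht)
        have h2 : 0 ≤ Real.exp (k * t) * k ^ 2 := by positivity
        nlinarith [mul_nonneg h2 (sub_nonneg.2 this)])
    simpa [hB0, hJ0] using anti self_mem_Ici ht ht
  have second : Real.exp (-k * t) * J t + A * (Real.exp (-2 * k * t) / (2 * k)) ≤ A / (2 * k) := by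
    have hd : ∀ t, HasDerivAt
        (fun t => Real.exp (-k * t) * J t + A * (Real.exp (-2 * k * t) / (2 * k)))
        (Real.exp (-k * t) * -k * J t + Real.exp (-k * t) * B t +
          A * (Real.exp (-2 * k * t) * (-2 * k) / (2 * k))) t :=
      fun t => ((hexp (-k) t).mul (hJd t)).add (((hexp (-2 * k) t).div_const _).const_mul A)
    have anti := antitoneOn_of_hasDerivWithinAt_nonpos (convex_Ici (0 : ℝ))
      (fun t _ => (hd t).continuousAt.continuousWithinAt) (fun t _ => (hd t).hasDerivWithinAt)
      (fun t ht => by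
        rw [interior_Ici] at ht
        have h1 := first t (le_of_lt ht)
        have h2 : Real.exp (-2 * k * t) = Real.exp (-k * t) * Real.exp (-k * t) := by
          rw [← Real.exp_add]; ring_nf
        have h3 : Real.exp (-k * t) * Real.exp (k * t) = 1 := by
          rw [← Real.exp_add]; simp
        have h4 : A * (Real.exp (-2 * k * t) * (-2 * k) / (2 * k)) =
            -(A * Real.exp (-2 * k * t)) := by field_simp
        rw [h4, h2]
        have h5 := mul_le_mul_of_nonneg_left h1
          (mul_self_nonneg (Real.exp (-k * t)))
        have h6 : Real.exp (-k * t) * Real.exp (-k * t) * (Real.exp (k * t) * (B t - k * J t)) =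
            Real.exp (-k * t) * (B t - k * J t) := by
          linear_combination Real.exp (-k * t) * (B t - k * J t) * h3
        nlinarith)
    have := anti self_mem_Ici ht ht
    simpa [hJ0, div_eq_mul_inv] using this
  refine (hvJ t ht).trans ?_
  have h3 : Real.exp (k * t) * Real.exp (-k * t) = 1 := by rw [← Real.exp_add]; simp
  have h2 : Real.exp (-2 * k * t) = Real.exp (-k * t) * Real.exp (-k * t) := by
    rw [← Real.exp_add]; ring_nf
  have h7 := mul_le_mul_of_nonneg_left second (Real.exp_pos (k * t)).le
  rw [Real.sinh_eq, h2] at *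
  have h8 : Real.exp (k * t) * (Real.exp (-k * t) * J t +
      A * (Real.exp (-k * t) * Real.exp (-k * t) / (2 * k))) =
      J t + A * Real.exp (-k * t) / (2 * k) := by
    linear_combination (J t + A * Real.exp (-k * t) / (2 * k)) * h3
  rw [h8] at h7
  have h9 : A * ((Real.exp (k * t) - Real.exp (-(k * t))) / 2 / k) =
      Real.exp (k * t) * (A / (2 * k)) - A * Real.exp (-k * t) / (2 * k) := by
    rw [neg_mul]; field_simp
  rw [h9]; linarith

/-- Sturm comparison for `v'' = q v` with `-δ² ≤ Re q`: the solution grows at least like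
`sin (δ t) / δ`, up to the first zero of the latter. -/
theorem sin_le_norm_of_hasDerivAt {v v' q : ℝ → ℂ} {δ : ℝ} (hδ : 0 < δ)
    (hv : ∀ t, HasDerivAt v (v' t) t) (hv' : ∀ t, HasDerivAt v' (q t * v t) t)
    (hq : ∀ t, -δ ^ 2 ≤ (q t).re) (h0 : v 0 = 0) {t : ℝ} (ht : 0 ≤ t) (htδ : t ≤ Real.pi / δ) :
    ‖v' 0‖ * (Real.sin (δ * t) / δ) ≤ ‖v t‖ := by
  rcases ht.eq_or_lt with rfl | ht
  · simp
  rcases htδ.eq_or_lt with rfl | htδ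
  · simp [mul_div_cancel₀ _ hδ.ne']
  set I := Ioo (0 : ℝ) (Real.pi / δ)
  have hs : ∀ t ∈ I, 0 < Real.sin (δ * t) := fun t ht =>
    Real.sin_pos_of_pos_of_lt_pi (mul_pos hδ ht.1) (by
      have := (lt_div_iff₀ hδ).1 ht.2; linarith)
  have hsd : ∀ t : ℝ, HasDerivAt (fun t => Real.sin (δ * t)) (Real.cos (δ * t) * δ) t :=
    fun t => by simpa using ((hasDerivAt_id t).const_mul δ).sin
  have hcd : ∀ t : ℝ, HasDerivAt (fun t => Real.cos (δ * t)) (-Real.sin (δ * t) * δ) t :=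
    fun t => by simpa using ((hasDerivAt_id t).const_mul δ).cos
  have hre : ∀ {w : ℝ → ℂ} {w' : ℂ} {t : ℝ}, HasDerivAt w w' t →
      HasDerivAt (fun t => (w t).re) w'.re t := fun h =>
    (Complex.reCLM.hasFDerivAt.comp_hasDerivAt _ h)
  have him : ∀ {w : ℝ → ℂ} {w' : ℂ} {t : ℝ}, HasDerivAt w w' t →
      HasDerivAt (fun t => (w t).im) w'.im t := fun h =>
    (Complex.imCLM.hasFDerivAt.comp_hasDerivAt _ h)
  set N : ℝ → ℝ := fun t => (v t).re * (v t).re + (v t).im * (v t).im with hN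
  have hNnorm : ∀ t, N t = ‖v t‖ ^ 2 := fun t => by
    rw [Complex.sq_norm, Complex.normSq_apply]
  have hNd : ∀ t, HasDerivAt N (2 * ((v t).re * (v' t).re + (v t).im * (v' t).im)) t :=
    fun t => (((hre (hv t)).mul (hre (hv t))).add ((him (hv t)).mul (him (hv t)))).congr_deriv
      (by ring)
  -- Riccati trick: `M` is `sin² / 2` times the derivative of `‖v‖² / sin²`, and `M'` is a sum of
  -- squares plus `(Re q + δ²) ‖v‖²`.
  set M : ℝ → ℝ := fun t => ((v t).re * (v' t).re + (v t).im * (v' t).im) -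
    N t * (Real.cos (δ * t) * δ / Real.sin (δ * t)) with hM
  have hMd : ∀ t ∈ I, HasDerivAt M
      (((v' t).re - (v t).re * (Real.cos (δ * t) * δ / Real.sin (δ * t))) ^ 2 +
        ((v' t).im - (v t).im * (Real.cos (δ * t) * δ / Real.sin (δ * t))) ^ 2 +
        ((q t).re + δ ^ 2) * N t) t := by
    intro t ht
    have hst := (hs t ht).ne'
    refine ((((hre (hv t)).mul (hre (hv' t))).add ((him (hv t)).mul (him (hv' t)))).sub
      ((hNd t).mul (((hcd t).mul_const δ).div (hsd t) hst))).congr_deriv ?_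
    simp only [Complex.mul_re, Complex.mul_im, hN, Pi.div_apply]
    have := Real.sin_sq_add_cos_sq (δ * t)
    field_simp
    generalize Real.sin (δ * t) = S at *
    generalize Real.cos (δ * t) = C at *
    ring
  have hslope : Tendsto (fun t => ‖v t‖ / Real.sin (δ * t)) (𝓝[>] 0) (𝓝 (‖v' 0‖ / δ)) := by
    have h1 : Tendsto (fun t => t⁻¹ • (v t)) (𝓝[>] 0) (𝓝 (v' 0)) := by
      simpa [h0] using (hv 0).tendsto_slope_zero_right
    have h2 : Tendsto (fun t => t⁻¹ • Real.sin (δ * t)) (𝓝[>] 0) (𝓝 δ) := by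
      simpa using (hsd 0).tendsto_slope_zero_right
    refine (h1.norm.div h2 hδ.ne').congr' ?_
    filter_upwards [self_mem_nhdsWithin] with t ht
    have : (0 : ℝ) < t := ht
    simp only [Pi.div_apply, norm_smul, Real.norm_eq_abs, abs_inv, abs_of_pos this, smul_eq_mul]
    field_simp
  have hnear : ∀ {a : ℝ}, a ∈ I → ∀ᶠ τ in 𝓝[>] (0 : ℝ), τ ∈ Ioo 0 a := fun ha =>
    Ioo_mem_nhdsGT ha.1
  have hM0 : Tendsto M (𝓝[>] 0) (𝓝 0) := by
    have hvc : ContinuousAt v 0 := (hv 0).continuousAt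
    have hvc' : ContinuousAt v' 0 := (hv' 0).continuousAt
    have e1 : Tendsto (fun t => (v t).re * (v' t).re + (v t).im * (v' t).im) (𝓝[>] 0) (𝓝 0) := by
      have : ContinuousAt (fun t => (v t).re * (v' t).re + (v t).im * (v' t).im) 0 := by
        fun_prop
      simpa [h0] using this.tendsto.mono_left nhdsWithin_le_nhds
    have e2 : Tendsto (fun t => ‖v t‖ * (Real.cos (δ * t) * δ)) (𝓝[>] 0) (𝓝 0) := by
      have : ContinuousAt (fun t => ‖v t‖ * (Real.cos (δ * t) * δ)) 0 := by fun_prop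
      simpa [h0] using this.tendsto.mono_left nhdsWithin_le_nhds
    -- The term `‖v‖² cot` is indeterminate at `0`; it is split as `‖v‖ cos` times the convergent
    -- quotient `‖v‖ / sin`.
    have := e1.sub (e2.mul hslope)
    simp only [zero_mul, sub_zero] at this
    refine this.congr fun t => ?_
    simp only [hM, hNnorm]; ring
  have hMnonneg : ∀ t ∈ I, 0 ≤ M t := by
    have mono : MonotoneOn M I := monotoneOn_of_hasDerivWithinAt_nonneg (convex_Ioo _ _)
      (fun t ht => (hMd t ht).continuousAt.continuousWithinAt)
      (fun t ht => by rw [interior_Ioo] at ht; exact (hMd t ht).hasDerivWithinAt)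
      (fun t ht => by
        have h1 := hq t
        have h2 : 0 ≤ ((q t).re + δ ^ 2) * N t :=
          mul_nonneg (by linarith) (by rw [hNnorm]; positivity)
        positivity)
    intro t ht
    refine le_of_tendsto hM0 ?_
    filter_upwards [hnear ht] with τ hτ
    exact mono ⟨hτ.1, hτ.2.trans ht.2⟩ ht hτ.2.le
  have hRd : ∀ t ∈ I, HasDerivAt (fun t => N t / Real.sin (δ * t) ^ 2)
      (2 * M t / Real.sin (δ * t) ^ 2) t := by
    intro t ht
    have hst := (hs t ht).ne'
    refine ((hNd t).div ((hsd t).pow 2) (pow_ne_zero 2 hst)).congr_deriv ?_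
    simp only [hM]
    field_simp
    simp
    ring
  have mono : MonotoneOn (fun t => N t / Real.sin (δ * t) ^ 2) I :=
    monotoneOn_of_hasDerivWithinAt_nonneg (convex_Ioo _ _)
      (fun t ht => (hRd t ht).continuousAt.continuousWithinAt)
      (fun t ht => by rw [interior_Ioo] at ht; exact (hRd t ht).hasDerivWithinAt)
      (fun t ht => by
        rw [interior_Ioo] at ht
        have := hMnonneg t ht
        positivity)
  have htI : t ∈ I := ⟨ht, htδ⟩
  have key : (‖v' 0‖ / δ) ^ 2 ≤ (‖v t‖ / Real.sin (δ * t)) ^ 2 := by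
    refine le_of_tendsto (hslope.pow 2) ?_
    filter_upwards [hnear htI] with τ hτ
    have := mono ⟨hτ.1, hτ.2.trans htδ⟩ htI hτ.2.le
    simpa only [hNnorm, div_pow] using this
  have hst := hs t htI
  have key2 := le_of_sq_le_sq key (by positivity)
  rw [le_div_iff₀ hst] at key2
  calc _ = ‖v' 0‖ / δ * Real.sin (δ * t) := by ring
    _ ≤ _ := key2

/-! ### Möbius maps and the Schwarz–Pick lemma -/

theorem normSq_one_add_conj_mul_sub (a z : ℂ) :
    ‖1 + (starRingEnd ℂ) a * z‖ ^ 2 - ‖a + z‖ ^ 2 = (1 - ‖a‖ ^ 2) * (1 - ‖z‖ ^ 2) := by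
  simp only [Complex.sq_norm, Complex.normSq_apply, Complex.add_re, Complex.add_im, Complex.mul_re,
    Complex.mul_im, Complex.one_re, Complex.one_im, Complex.conj_re, Complex.conj_im]
  ring

theorem one_add_conj_mul_ne_zero {a z : ℂ} (ha : ‖a‖ < 1) (hz : ‖z‖ < 1) :
    1 + (starRingEnd ℂ) a * z ≠ 0 := by
  intro h
  have h1 : ‖(starRingEnd ℂ) a * z‖ = 1 := by
    rw [eq_neg_of_add_eq_zero_right h]; simp
  rw [norm_mul, RCLike.norm_conj] at h1
  nlinarith [norm_nonneg a, norm_nonneg z]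

theorem norm_mobius_lt_one {a z : ℂ} (ha : ‖a‖ < 1) (hz : ‖z‖ < 1) :
    ‖(a + z) / (1 + (starRingEnd ℂ) a * z)‖ < 1 := by
  rw [norm_div, div_lt_one (norm_pos_iff.2 (one_add_conj_mul_ne_zero ha hz))]
  have h1 := normSq_one_add_conj_mul_sub a z
  have h2 : 0 < (1 - ‖a‖ ^ 2) * (1 - ‖z‖ ^ 2) := by
    apply mul_pos <;> nlinarith [norm_nonneg a, norm_nonneg z]
  exact lt_of_pow_lt_pow_left₀ 2 (norm_nonneg _) (by linarith)

theorem hasDerivAt_mobius {a z : ℂ} (h : 1 + (starRingEnd ℂ) a * z ≠ 0) :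
    HasDerivAt (fun z => (a + z) / (1 + (starRingEnd ℂ) a * z))
      ((1 - (‖a‖ : ℂ) ^ 2) / (1 + (starRingEnd ℂ) a * z) ^ 2) z := by
  refine (((hasDerivAt_id z).const_add a).div
    (((hasDerivAt_id z).const_mul ((starRingEnd ℂ) a)).const_add 1) h).congr_deriv ?_
  rw [← Complex.conj_mul' a]
  simp only [id]
  ring

/-- The **Schwarz–Pick lemma** for maps into the open disk, at the level of derivatives. -/
theorem norm_deriv_mul_le_of_mapsTo_ball {φ : ℂ → ℂ} (hd : DifferentiableOn ℂ φ (ball 0 1))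
    (hm : MapsTo φ (ball 0 1) (ball 0 1)) {z : ℂ} (hz : ‖z‖ < 1) :
    ‖deriv φ z‖ * (1 - ‖z‖ ^ 2) ≤ 1 - ‖φ z‖ ^ 2 := by
  have hm' : ∀ {w : ℂ}, ‖w‖ < 1 → ‖φ w‖ < 1 := fun hw =>
    mem_ball_zero_iff.1 (hm (mem_ball_zero_iff.2 hw))
  have hda : ∀ {w : ℂ}, ‖w‖ < 1 → DifferentiableAt ℂ φ w := fun hw =>
    hd.differentiableAt (isOpen_ball.mem_nhds (mem_ball_zero_iff.2 hw))
  have ha : ‖-φ z‖ < 1 := by simpa using hm' hz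
  -- Disk automorphisms before and after `φ` move `z` and `φ z` to `0`, reducing to the Schwarz
  -- lemma at the origin.
  set G : ℂ → ℂ := fun ζ => (-φ z + φ ((z + ζ) / (1 + (starRingEnd ℂ) z * ζ))) /
    (1 + (starRingEnd ℂ) (-φ z) * φ ((z + ζ) / (1 + (starRingEnd ℂ) z * ζ))) with hG
  have hGd : ∀ ζ : ℂ, ‖ζ‖ < 1 → HasDerivAt G
      ((1 - (‖-φ z‖ : ℂ) ^ 2) /
        (1 + (starRingEnd ℂ) (-φ z) * φ ((z + ζ) / (1 + (starRingEnd ℂ) z * ζ))) ^ 2 *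
        (deriv φ ((z + ζ) / (1 + (starRingEnd ℂ) z * ζ)) *
          ((1 - (‖z‖ : ℂ) ^ 2) / (1 + (starRingEnd ℂ) z * ζ) ^ 2))) ζ := fun ζ hζ => by
    have h1 := hasDerivAt_mobius (one_add_conj_mul_ne_zero hz hζ)
    have h2 := (hda (norm_mobius_lt_one hz hζ)).hasDerivAt
    have h3 := hasDerivAt_mobius (one_add_conj_mul_ne_zero ha (hm' (norm_mobius_lt_one hz hζ)))
    exact HasDerivAt.comp ζ h3 (HasDerivAt.comp ζ h2 h1)
  have hG0 : G 0 = 0 := by simp [hG]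
  have key := Complex.norm_deriv_le_one_of_mapsTo_ball (f := G) (c := 0) (R := 1)
    (fun ζ hζ => (hGd ζ (mem_ball_zero_iff.1 hζ)).differentiableAt.differentiableWithinAt)
    (fun ζ hζ => by
      rw [hG0, mem_closedBall_zero_iff]
      exact (norm_mobius_lt_one ha (hm' (norm_mobius_lt_one hz (mem_ball_zero_iff.1 hζ)))).le)
    one_pos
  have h1 : (0 : ℝ) < 1 - ‖φ z‖ ^ 2 := by nlinarith [hm' hz, norm_nonneg (φ z)]
  have h2 : (0 : ℝ) < 1 - ‖z‖ ^ 2 := by nlinarith [norm_nonneg z]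
  have e1 : ((1 : ℂ) - (‖-φ z‖ : ℂ) ^ 2) = ((1 - ‖φ z‖ ^ 2 : ℝ) : ℂ) := by push_cast; simp
  have e2 : ((1 : ℂ) - (‖z‖ : ℂ) ^ 2) = ((1 - ‖z‖ ^ 2 : ℝ) : ℂ) := by push_cast; simp
  have e3 : (1 + (starRingEnd ℂ) (-φ z) * φ z) = ((1 - ‖φ z‖ ^ 2 : ℝ) : ℂ) := by
    push_cast; rw [← Complex.conj_mul', map_neg]; ring
  rw [(hGd 0 (by simp)).deriv] at key
  simp only [add_zero, mul_zero, div_one, one_pow] at key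
  rw [e1, e2, e3, norm_mul, norm_mul, norm_div, norm_pow, Complex.norm_of_nonneg h1.le,
    Complex.norm_of_nonneg h2.le] at key
  have e4 : (1 - ‖φ z‖ ^ 2) / (1 - ‖φ z‖ ^ 2) ^ 2 = (1 - ‖φ z‖ ^ 2)⁻¹ := by
    have := h1.ne'
    field_simp
  rw [e4, inv_mul_le_iff₀ h1, mul_one] at key
  exact key

/-- The **Schwarz–Pick lemma** for maps into the closed disk, at the level of derivatives. -/
theorem norm_deriv_mul_le_of_mapsTo_closedBall {φ : ℂ → ℂ}
    (hd : DifferentiableOn ℂ φ (ball 0 1)) (hm : MapsTo φ (ball 0 1) (closedBall 0 1)) {z : ℂ}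
    (hz : ‖z‖ < 1) : ‖deriv φ z‖ * (1 - ‖z‖ ^ 2) ≤ 1 - ‖φ z‖ ^ 2 := by
  -- `r φ` maps into the open disk for `r < 1`; then let `r → 1`.
  have key : ∀ r ∈ Ioo (0 : ℝ) 1,
      r * ‖deriv φ z‖ * (1 - ‖z‖ ^ 2) ≤ 1 - (r * ‖φ z‖) ^ 2 := by
    intro r hr
    have := norm_deriv_mul_le_of_mapsTo_ball (φ := fun w => (r : ℂ) * φ w) (hd.const_mul _)
      (fun w hw => by
        have h1 := mem_closedBall_zero_iff.1 (hm hw)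
        rw [mem_ball_zero_iff, norm_mul, Complex.norm_of_nonneg hr.1.le]
        nlinarith [hr.1, hr.2]) hz
    rwa [deriv_const_mul_field, norm_mul, norm_mul, Complex.norm_of_nonneg hr.1.le] at this
  have c1 : Continuous fun r : ℝ => r * ‖deriv φ z‖ * (1 - ‖z‖ ^ 2) := by fun_prop
  have c2 : Continuous fun r : ℝ => 1 - (r * ‖φ z‖) ^ 2 := by fun_prop
  have := le_of_tendsto_of_tendsto ((c1.tendsto 1).mono_left nhdsWithin_le_nhds)
    ((c2.tendsto 1).mono_left nhdsWithin_le_nhds)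
    (Filter.eventually_of_mem (Ioo_mem_nhdsLT one_pos) key)
  simpa using this

/-! ### The Schwarzian estimate -/

/-- Points of this half-plane are closer to `0` than to `β`, so `w / (w - β)` sends it into the unit
disk. -/
theorem norm_lt_norm_sub_of_re_lt {β : ℝ} (hβ : 0 < β) {w : ℂ} (h : w.re < β / 2) :
    ‖w‖ < ‖w - β‖ := by
  refine lt_of_pow_lt_pow_left₀ 2 (norm_nonneg _) ?_
  rw [Complex.sq_norm, Complex.sq_norm, Complex.normSq_apply, Complex.normSq_apply]
  simp only [Complex.sub_re, Complex.sub_im, Complex.ofReal_re, Complex.ofReal_im]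
  nlinarith

/-- If `T` is holomorphic on the disk and `Re (z T z) < β / 2`, then
`T = -β φ / (1 - z φ)` with `φ = T / (z T - β)` bounded by one. -/
theorem norm_div_le_one_of_re_lt {T : ℂ → ℂ} {β : ℝ} (hβ : 0 < β)
    (hT : DifferentiableOn ℂ T (ball 0 1))
    (hre : ∀ z ∈ ball (0 : ℂ) 1, (z * T z).re < β / 2) :
    DifferentiableOn ℂ (fun z => T z / (z * T z - β)) (ball 0 1) ∧
      MapsTo (fun z => T z / (z * T z - β)) (ball 0 1) (closedBall 0 1) := by
  have hpos : ∀ z ∈ ball (0 : ℂ) 1, 0 < ‖z * T z - β‖ := fun z hz =>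
    (norm_nonneg _).trans_lt (norm_lt_norm_sub_of_re_lt hβ (hre z hz))
  have hd : DifferentiableOn ℂ (fun z => T z / (z * T z - β)) (ball 0 1) :=
    hT.div ((differentiableOn_id.mul hT).sub_const _) fun z hz => norm_pos_iff.1 (hpos z hz)
  refine ⟨hd, fun z hz => ?_⟩
  set φ : ℂ → ℂ := fun z => T z / (z * T z - β) with hφ
  have hw : DifferentiableOn ℂ (fun z => z * φ z) (ball 0 1) := differentiableOn_id.mul hd
  have hmaps : MapsTo (fun z => z * φ z) (ball (0 : ℂ) 1) (closedBall ((0 : ℂ) * φ 0) 1) := by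
    intro z hz
    simp only [zero_mul, mem_closedBall_zero_iff, hφ]
    rw [← mul_div_assoc, norm_div, div_le_one (hpos z hz)]
    exact (norm_lt_norm_sub_of_re_lt hβ (hre z hz)).le
  rw [mem_closedBall_zero_iff]
  -- The Schwarz lemma for `z φ z` gives `‖z φ z‖ ≤ ‖z‖`, which says nothing at `0`; there `φ 0` is
  -- the derivative of `z φ z`.
  rcases eq_or_ne z 0 with rfl | h0
  · have h1 := Complex.norm_deriv_le_one_of_mapsTo_ball hw hmaps one_pos
    have h2 : HasDerivAt (fun z => z * φ z) (1 * φ 0 + 0 * deriv φ 0) 0 :=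
      (hasDerivAt_id (0 : ℂ)).mul (hd.differentiableAt (isOpen_ball.mem_nhds hz)).hasDerivAt
    rw [h2.deriv] at h1
    simpa using h1
  · have h1 := Complex.dist_le_dist_of_mapsTo_ball hw hmaps hz
    simp only [zero_mul, dist_zero_right, norm_mul] at h1
    exact le_of_mul_le_mul_left (by linarith) (norm_pos_iff.2 h0)

/-- The real-variable inequality behind the Schwarzian estimate. -/
theorem schwarzian_bound_aux {β r s d : ℝ} (hβ : 0 ≤ β) (hr : 0 ≤ r) (hr1 : r < 1) (hs : 0 ≤ s)
    (hs1 : s ≤ 1) (hd : d * (1 - r ^ 2) ≤ 1 - s ^ 2) :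
    (d + (1 + β / 2) * s ^ 2) * (1 - r ^ 2) ^ 2 ≤ (4 + 2 * β) * (1 - r * s) ^ 2 := by
  have hrs : r * s ≤ r := mul_le_of_le_one_right hr hs1
  have h1 : 0 < 1 - r ^ 2 := by nlinarith
  have hx : 0 ≤ (1 - r ^ 2) * s := by positivity
  have hy : (1 - r ^ 2) * s ≤ 2 * (1 - r * s) := by nlinarith [mul_nonneg hs (sq_nonneg (1 - r))]
  have hb : ((1 - r ^ 2) * s) ^ 2 ≤ 4 * (1 - r * s) ^ 2 := by nlinarith
  have hc : (1 - r ^ 2) * (1 + r * s) ≤ 4 * (1 - r * s) := by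
    have e1 : 1 + r * s ≤ 2 := by linarith
    have e2 : 1 - r ^ 2 ≤ 2 * (1 - r) := by nlinarith
    have e3 : 0 ≤ r * s := by positivity
    nlinarith
  -- The left side factors as `(1 - r²)(1 - rs)(1 + rs)`. This settles the part without `β`; `hb`
  -- settles the part linear in `β`.
  have hc' : (1 - r ^ 2) * (1 - s ^ 2) + ((1 - r ^ 2) * s) ^ 2 ≤ 4 * (1 - r * s) ^ 2 := by
    have : 0 ≤ 1 - r * s := by linarith
    nlinarith [mul_le_mul_of_nonneg_right hc this]
  have hd' := mul_le_mul_of_nonneg_right hd h1.le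
  nlinarith [mul_le_mul_of_nonneg_left hb hβ]

/-- With `T = -βφ/(1 - zφ)` the expression becomes `-(β/2)(φ' + (1 + β/2)φ²)/(1 - zφ)²`.
Schwarz–Pick and `schwarzian_bound_aux` then give the constant `(β/2)(4 + 2β)`. -/
theorem norm_schwarzian_le {T : ℂ → ℂ} {β : ℝ} (hβ : 0 < β) (hT : DifferentiableOn ℂ T (ball 0 1))
    (hre : ∀ z ∈ ball (0 : ℂ) 1, (z * T z).re < β / 2) {z : ℂ} (hz : ‖z‖ < 1) :
    ‖deriv T z / 2 - T z ^ 2 / 4‖ * (1 - ‖z‖ ^ 2) ^ 2 ≤ β ^ 2 + 2 * β := by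
  obtain ⟨hd, hm⟩ := norm_div_le_one_of_re_lt hβ hT hre
  have hzb : z ∈ ball (0 : ℂ) 1 := mem_ball_zero_iff.2 hz
  have hne : z * T z - β ≠ 0 := norm_pos_iff.1 <|
    (norm_nonneg _).trans_lt (norm_lt_norm_sub_of_re_lt hβ (hre z hzb))
  have hTd := (hT.differentiableAt (isOpen_ball.mem_nhds hzb)).hasDerivAt
  have hder := (hTd.div (((hasDerivAt_id z).mul hTd).sub_const (β : ℂ)) hne).deriv
  have hp := norm_deriv_mul_le_of_mapsTo_closedBall hd hm hz
  have hs1 : ‖T z / (z * T z - β)‖ ≤ 1 := mem_closedBall_zero_iff.1 (hm hzb)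
  have aux := schwarzian_bound_aux hβ.le (norm_nonneg z) hz (norm_nonneg _) hs1 hp
  set D := deriv (fun z => T z / (z * T z - β)) z with hD
  have hD' : D = (deriv T z * (z * T z - β) - T z * (1 * T z + z * deriv T z)) /
      (z * T z - β) ^ 2 := hder
  set s := T z / (z * T z - β) with hs
  have hβ0 : (β : ℂ) ≠ 0 := by exact_mod_cast hβ.ne'
  have h1s : 1 - z * s = -β / (z * T z - β) := by rw [hs]; field_simp; ring
  have h1s0 : 1 - z * s ≠ 0 := by rw [h1s]; exact div_ne_zero (neg_ne_zero.2 hβ0) hne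
  have hS : deriv T z / 2 - T z ^ 2 / 4 =
      -(β / 2) * (D + (1 + β / 2) * s ^ 2) / (1 - z * s) ^ 2 := by
    rw [h1s, hD', hs]
    generalize hX : z * T z - β = X at hne
    field_simp
    rw [← hX]
    ring
  have hlow : 1 - ‖z‖ * ‖s‖ ≤ ‖1 - z * s‖ := by
    have := norm_sub_norm_le (1 : ℂ) (z * s)
    simpa using this
  have hlow0 : 0 ≤ 1 - ‖z‖ * ‖s‖ := by nlinarith [norm_nonneg z, norm_nonneg s]
  have hup : ‖D + (1 + β / 2) * s ^ 2‖ ≤ ‖D‖ + (1 + β / 2) * ‖s‖ ^ 2 := by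
    refine (norm_add_le _ _).trans_eq ?_
    rw [norm_mul, norm_pow, show (1 + β / 2 : ℂ) = ((1 + β / 2 : ℝ) : ℂ) by push_cast; rfl,
      Complex.norm_of_nonneg (by positivity)]
  have hβn : ‖-((β : ℂ) / 2)‖ = β / 2 := by
    rw [norm_neg, show (β / 2 : ℂ) = ((β / 2 : ℝ) : ℂ) by push_cast; rfl,
      Complex.norm_of_nonneg (by positivity)]
  rw [hS, norm_div, norm_mul, norm_pow, hβn, div_mul_eq_mul_div,
    div_le_iff₀ (pow_pos (norm_pos_iff.2 h1s0) 2)]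
  have hsq : (1 - ‖z‖ * ‖s‖) ^ 2 ≤ ‖1 - z * s‖ ^ 2 := by gcongr
  calc β / 2 * ‖D + (1 + β / 2) * s ^ 2‖ * (1 - ‖z‖ ^ 2) ^ 2
      ≤ β / 2 * (‖D‖ + (1 + β / 2) * ‖s‖ ^ 2) * (1 - ‖z‖ ^ 2) ^ 2 := by gcongr
    _ = β / 2 * ((‖D‖ + (1 + β / 2) * ‖s‖ ^ 2) * (1 - ‖z‖ ^ 2) ^ 2) := by ring
    _ ≤ β / 2 * ((4 + 2 * β) * (1 - ‖z‖ * ‖s‖) ^ 2) := by gcongr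
    _ ≤ β / 2 * ((4 + 2 * β) * ‖1 - z * s‖ ^ 2) := by gcongr
    _ = _ := by ring

/-! ### The pre-Schwarzian and the square root of `1 / f'` -/

/-- The pre-Schwarzian derivative `f'' / f'`. -/
noncomputable def preSchwarzian (f : ℂ → ℂ) (z : ℂ) : ℂ := deriv (deriv f) z / deriv f z

namespace IsClassG

variable {β : ℝ} {f : ℂ → ℂ}

theorem differentiableOn_deriv (hf : IsClassG β f) : DifferentiableOn ℂ (deriv f) (ball 0 1) :=
  hf.analytic.deriv isOpen_ball

theorem differentiableOn_preSchwarzian (hf : IsClassG β f) :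
    DifferentiableOn ℂ (preSchwarzian f) (ball 0 1) :=
  (hf.differentiableOn_deriv.deriv isOpen_ball).div hf.differentiableOn_deriv hf.deriv_ne_zero

theorem re_mul_preSchwarzian_lt (hf : IsClassG β f) {z : ℂ} (hz : z ∈ ball (0 : ℂ) 1) :
    (z * preSchwarzian f z).re < β / 2 := by
  have := hf.re_lt z hz
  rw [Complex.add_re, Complex.one_re, mul_div_assoc] at this
  exact lt_of_add_lt_add_left this

/-- A holomorphic branch of `1 / √f'` on the disk, with its logarithmic derivative. -/
theorem exists_inv_sqrt_deriv (hf : IsClassG β f) : ∃ h : ℂ → ℂ, ∀ z ∈ ball (0 : ℂ) 1,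
    HasDerivAt h (-(preSchwarzian f z) / 2 * h z) z ∧ h z ≠ 0 ∧ deriv f z = 1 / h z ^ 2 := by
  -- A primitive of `f''/f'` serves as `log f'`, so `exp (-F / 2)` is the required branch.
  obtain ⟨F, hF0, hF⟩ := hf.differentiableOn_preSchwarzian.isExactOn_ball.with_val_at 0 0
  have hda : ∀ z ∈ ball (0 : ℂ) 1, HasDerivAt (fun z => deriv f z * Complex.exp (-F z)) 0 z := by
    intro z hz
    have h1 := (hf.differentiableOn_deriv.differentiableAt (isOpen_ball.mem_nhds hz)).hasDerivAt
    refine (h1.mul (hF z hz).neg.cexp).congr_deriv ?_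
    have := hf.deriv_ne_zero z hz
    simp only [preSchwarzian]
    field_simp
    ring
  have hconst : ∀ z ∈ ball (0 : ℂ) 1, deriv f z * Complex.exp (-F z) = 1 := by
    intro z hz
    have := isOpen_ball.is_const_of_deriv_eq_zero (convex_ball (0 : ℂ) 1).isPreconnected
      (fun z hz => (hda z hz).differentiableAt.differentiableWithinAt)
      (fun z hz => (hda z hz).deriv) hz (mem_ball_self one_pos)
    simpa [hF0, hf.deriv_zero] using this
  refine ⟨fun z => Complex.exp (-F z / 2), fun z hz => ⟨?_, Complex.exp_ne_zero _, ?_⟩⟩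
  · exact ((hF z hz).neg.div_const 2).cexp.congr_deriv (by simp only [Pi.neg_apply]; ring)
  · rw [← Complex.exp_nat_mul, eq_div_iff (Complex.exp_ne_zero _)]
    convert hconst z hz using 3
    push_cast; ring

end IsClassG

/-! ### Geodesics and reduction to the differential equation -/

/-- The denominator of the unit speed hyperbolic geodesic from `a` in direction `e`. -/
noncomputable def geodesicDenom (a e : ℂ) (t : ℝ) : ℂ :=
  Real.cosh t + (starRingEnd ℂ) a * e * Real.sinh t

/-- The unit speed hyperbolic geodesic of the disk from `a` in direction `e`. -/
noncomputable def geodesic (a e : ℂ) (t : ℝ) : ℂ :=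
  (a * Real.cosh t + e * Real.sinh t) / geodesicDenom a e t

section Geodesic

variable {a e : ℂ}

theorem normSq_geodesicDenom_sub (he : ‖e‖ = 1) (t : ℝ) :
    ‖geodesicDenom a e t‖ ^ 2 - ‖a * Real.cosh t + e * Real.sinh t‖ ^ 2 = 1 - ‖a‖ ^ 2 := by
  have h1 := Real.cosh_sq t
  have h2 : e.re * e.re + e.im * e.im = 1 := by
    rw [← Complex.normSq_apply, ← Complex.sq_norm, he, one_pow]
  simp only [geodesicDenom, Complex.sq_norm, Complex.normSq_apply, Complex.add_re, Complex.add_im,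
    Complex.mul_re, Complex.mul_im, Complex.conj_re, Complex.conj_im, Complex.ofReal_re,
    Complex.ofReal_im]
  linear_combination (1 - a.re ^ 2 - a.im ^ 2) * h1 +
    (a.re ^ 2 + a.im ^ 2 - 1) * Real.sinh t ^ 2 * h2

theorem geodesicDenom_ne_zero (ha : ‖a‖ < 1) (he : ‖e‖ = 1) (t : ℝ) : geodesicDenom a e t ≠ 0 := by
  intro h
  have := normSq_geodesicDenom_sub (a := a) he t
  rw [h, norm_zero] at this
  nlinarith [norm_nonneg a, sq_nonneg ‖a * Real.cosh t + e * Real.sinh t‖]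

/-- Since `γ'` has numerator of modulus `1 - ‖a‖²` over the squared denominator, this is the unit
speed property `‖γ'‖ = 1 - ‖γ‖²`. -/
theorem normSq_geodesicDenom_mul (ha : ‖a‖ < 1) (he : ‖e‖ = 1) (t : ℝ) :
    ‖geodesicDenom a e t‖ ^ 2 * (1 - ‖geodesic a e t‖ ^ 2) = 1 - ‖a‖ ^ 2 := by
  have h0 := norm_ne_zero_iff.2 (geodesicDenom_ne_zero ha he t)
  rw [geodesic, norm_div, ← normSq_geodesicDenom_sub (a := a) he t]
  field_simp

theorem norm_geodesic_lt_one (ha : ‖a‖ < 1) (he : ‖e‖ = 1) (t : ℝ) : ‖geodesic a e t‖ < 1 := by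
  have h := normSq_geodesicDenom_mul ha he t
  have h1 : 0 < 1 - ‖a‖ ^ 2 := by nlinarith [norm_nonneg a]
  rw [← h] at h1
  have h2 := pos_of_mul_pos_right h1 (sq_nonneg _)
  nlinarith [norm_nonneg (geodesic a e t)]

@[simp] theorem geodesic_zero : geodesic a e 0 = a := by simp [geodesic, geodesicDenom]

theorem hasDerivAt_geodesicDenom (t : ℝ) : HasDerivAt (geodesicDenom a e)
    (Real.sinh t + (starRingEnd ℂ) a * e * Real.cosh t) t :=
  (Real.hasDerivAt_cosh t).ofReal_comp.add ((Real.hasDerivAt_sinh t).ofReal_comp.const_mul _)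

theorem hasDerivAt_geodesic (ha : ‖a‖ < 1) (he : ‖e‖ = 1) (t : ℝ) : HasDerivAt (geodesic a e)
    (e * (1 - (‖a‖ : ℂ) ^ 2) / geodesicDenom a e t ^ 2) t := by
  have h1 : HasDerivAt (fun t : ℝ => a * Real.cosh t + e * Real.sinh t)
      (a * Real.sinh t + e * Real.cosh t) t :=
    ((Real.hasDerivAt_cosh t).ofReal_comp.const_mul a).add
      ((Real.hasDerivAt_sinh t).ofReal_comp.const_mul e)
  refine (h1.div (hasDerivAt_geodesicDenom t) (geodesicDenom_ne_zero ha he t)).congr_deriv ?_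
  have h2 : ((Real.cosh t : ℝ) : ℂ) ^ 2 = (Real.sinh t : ℂ) ^ 2 + 1 := by
    exact_mod_cast Real.cosh_sq t
  rw [← Complex.conj_mul']
  congr 1
  simp only [geodesicDenom]
  linear_combination e * (1 - (starRingEnd ℂ) a * a) * h2

end Geodesic

/-- Along a geodesic the two-point distortion is the modulus of a solution of `v'' = q v`, where
`q - 1` is controlled by the Schwarzian derivative. -/
theorem IsClassG.exists_solution {β : ℝ} {f : ℂ → ℂ} (hf : IsClassG β f) (hβ : 0 < β) {a e : ℂ}
    (ha : ‖a‖ < 1) (he : ‖e‖ = 1) : ∃ v v' q : ℝ → ℂ,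
      (∀ t, HasDerivAt v (v' t) t) ∧ (∀ t, HasDerivAt v' (q t * v t) t) ∧
      (∀ t, ‖q t - 1‖ ≤ β ^ 2 + 2 * β) ∧ v 0 = 0 ∧ v' 0 ≠ 0 ∧
      ∀ t, ‖v t‖ = ‖v' 0‖ * twoPointDistortion f a (geodesic a e t) := by
  obtain ⟨h, hh⟩ := hf.exists_inv_sqrt_deriv
  set T := preSchwarzian f with hT
  set γ := geodesic a e with hγ
  set m := geodesicDenom a e with hm
  set E : ℂ := e * (1 - (‖a‖ : ℂ) ^ 2) with hE
  set m' : ℝ → ℂ := fun t => Real.sinh t + (starRingEnd ℂ) a * e * Real.cosh t with hm'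
  have hmd : ∀ t, HasDerivAt m (m' t) t := hasDerivAt_geodesicDenom
  have hmd' : ∀ t, HasDerivAt m' (m t) t := fun t =>
    (Real.hasDerivAt_sinh t).ofReal_comp.add ((Real.hasDerivAt_cosh t).ofReal_comp.const_mul _)
  have hm0 : ∀ t, m t ≠ 0 := geodesicDenom_ne_zero ha he
  have hγb : ∀ t, γ t ∈ ball (0 : ℂ) 1 := fun t =>
    mem_ball_zero_iff.2 (norm_geodesic_lt_one ha he t)
  have hγd : ∀ t, HasDerivAt γ (E / m t ^ 2) t := hasDerivAt_geodesic ha he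
  have hfd : ∀ t, HasDerivAt (fun t => f (γ t) - f a) (1 / h (γ t) ^ 2 * (E / m t ^ 2)) t := by
    intro t
    rw [← (hh _ (hγb t)).2.2]
    exact (HasDerivAt.comp t (hf.analytic.differentiableAt
      (isOpen_ball.mem_nhds (hγb t))).hasDerivAt (hγd t)).sub_const _
  have hhd : ∀ t, HasDerivAt (fun t => h (γ t)) (-(T (γ t)) / 2 * h (γ t) * (E / m t ^ 2)) t :=
    fun t => HasDerivAt.comp t (hh _ (hγb t)).1 (hγd t)
  have hTd : ∀ t, HasDerivAt (fun t => T (γ t)) (deriv T (γ t) * (E / m t ^ 2)) t := fun t =>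
    HasDerivAt.comp t (hf.differentiableOn_preSchwarzian.differentiableAt
      (isOpen_ball.mem_nhds (hγb t))).hasDerivAt (hγd t)
  have hh0 : ∀ t, h (γ t) ≠ 0 := fun t => (hh _ (hγb t)).2.1
  have hγ0 : γ 0 = a := geodesic_zero
  have hmz : m 0 = 1 := by simp [hm, geodesicDenom]
  have hP : 0 < 1 - ‖a‖ ^ 2 := by nlinarith [norm_nonneg a]
  have hEn : ‖E‖ = 1 - ‖a‖ ^ 2 := by
    rw [hE, norm_mul, he, one_mul, ← Complex.norm_of_nonneg hP.le]; push_cast; rfl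
  have hmn : ∀ t, ‖m t‖ ^ 2 * (1 - ‖γ t‖ ^ 2) = 1 - ‖a‖ ^ 2 := normSq_geodesicDenom_mul ha he
  -- Both `h` and `(f - f a) h` solve `y'' = -(S/2) y`. As `γ' = E / m²`, the factor `m` is
  -- `γ'^(-1/2)` up to a constant, the Liouville factor for the change of variable, and `m'' = m`
  -- contributes the `1` in `q`.
  refine ⟨fun t => (f (γ t) - f a) * (h (γ t) * m t),
    fun t => E / (h (γ t) * m t) +
      (f (γ t) - f a) * (h (γ t) * (-(T (γ t)) / 2 * (E / m t) + m' t)),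
    fun t => 1 - (deriv T (γ t) / 2 - T (γ t) ^ 2 / 4) * (E / m t ^ 2) ^ 2, ?_, ?_, ?_, ?_, ?_, ?_⟩
  · intro t
    refine ((hfd t).mul ((hhd t).mul (hmd t))).congr_deriv ?_
    have := hm0 t
    have := hh0 t
    simp only [Pi.mul_apply]
    field_simp
  · intro t
    have h1 := hm0 t
    have h2 := hh0 t
    refine (((hasDerivAt_const t E).div ((hhd t).mul (hmd t)) (mul_ne_zero h2 h1)).add
      ((hfd t).mul ((hhd t).mul ((((hTd t).neg.div_const 2).mul
        ((hasDerivAt_const t E).div (hmd t) h1)).add (hmd' t))))).congr_deriv ?_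
    simp only [Pi.mul_apply, Pi.div_apply, Pi.add_apply, Pi.neg_apply]
    field_simp
    ring
  · intro t
    have h1 := norm_schwarzian_le hβ hf.differentiableOn_preSchwarzian
      (fun z hz => hf.re_mul_preSchwarzian_lt hz) (norm_geodesic_lt_one ha he t)
    have h2 : ‖E / m t ^ 2‖ = 1 - ‖γ t‖ ^ 2 := by
      rw [norm_div, norm_pow, hEn, ← hmn t, mul_div_cancel_left₀]
      exact pow_ne_zero 2 (norm_ne_zero_iff.2 (hm0 t))
    rw [sub_sub_cancel_left, norm_neg, norm_mul, norm_pow, h2]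
    exact h1
  · simp [hγ0]
  · have h1 : h a ≠ 0 := by simpa [hγ0] using hh0 0
    have h2 : E ≠ 0 := norm_pos_iff.1 (hEn ▸ hP)
    simp [hγ0, hmz, h1, h2]
  · intro t
    have hA : 0 < ‖h a‖ := norm_pos_iff.2 (by simpa [hγ0] using hh0 0)
    have hH : 0 < ‖h (γ t)‖ := norm_pos_iff.2 (hh0 t)
    have hM : 0 < ‖m t‖ := norm_pos_iff.2 (hm0 t)
    have hQ : 0 < 1 - ‖γ t‖ ^ 2 := by
      nlinarith [norm_nonneg (γ t), mem_ball_zero_iff.1 (hγb t)]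
    have hroot : ((1 - ‖a‖ ^ 2) * ‖deriv f a‖) * ((1 - ‖γ t‖ ^ 2) * ‖deriv f (γ t)‖) =
        (‖m t‖ * (1 - ‖γ t‖ ^ 2) / (‖h a‖ * ‖h (γ t)‖)) ^ 2 := by
      rw [(hh _ (hγb t)).2.2, (hh _ (mem_ball_zero_iff.2 ha)).2.2, ← hmn t]
      simp only [norm_div, norm_pow, norm_one]
      field_simp
    rw [twoPointDistortion, hroot, Real.sqrt_sq (by positivity)]
    simp only [hγ0, sub_self, zero_mul, add_zero, hmz, mul_one, norm_mul, norm_div, hEn]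
    rw [← hmn t, norm_sub_rev (f a)]
    field_simp

/-! ### Hyperbolic distance and the two bounds -/

theorem pseudoHypDist_nonneg (z₁ z₂ : ℂ) : 0 ≤ pseudoHypDist z₁ z₂ := norm_nonneg _

theorem pseudoHypDist_lt_one {z₁ z₂ : ℂ} (h₁ : ‖z₁‖ < 1) (h₂ : ‖z₂‖ < 1) :
    pseudoHypDist z₁ z₂ < 1 := by
  have h := norm_mobius_lt_one (a := -z₁) (by simpa using h₁) h₂
  have e : (-z₁ + z₂) / (1 + (starRingEnd ℂ) (-z₁) * z₂) =
      -((z₁ - z₂) / (1 - (starRingEnd ℂ) z₁ * z₂)) := by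
    rw [map_neg, ← neg_div, neg_sub, neg_mul, ← sub_eq_add_neg, neg_add_eq_sub]
  rwa [e, norm_neg] at h

theorem hypDist_eq_artanh {z₁ z₂ : ℂ} (h : pseudoHypDist z₁ z₂ < 1) :
    hypDist z₁ z₂ = Real.artanh (pseudoHypDist z₁ z₂) := by
  have := pseudoHypDist_nonneg z₁ z₂
  rw [Real.artanh_eq_half_log ⟨by linarith, h.le⟩, hypDist]

theorem hypDist_nonneg {z₁ z₂ : ℂ} (h : pseudoHypDist z₁ z₂ < 1) : 0 ≤ hypDist z₁ z₂ := by
  rw [hypDist_eq_artanh h]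
  exact Real.artanh_nonneg (pseudoHypDist_nonneg _ _)

theorem tanh_hypDist {z₁ z₂ : ℂ} (h : pseudoHypDist z₁ z₂ < 1) :
    Real.tanh (hypDist z₁ z₂) = pseudoHypDist z₁ z₂ := by
  have := pseudoHypDist_nonneg z₁ z₂
  rw [hypDist_eq_artanh h, Real.tanh_artanh ⟨by linarith, h⟩]

theorem geodesic_eq_mobius (a e : ℂ) (t : ℝ) : geodesic a e t =
    (a + e * Real.tanh t) / (1 + (starRingEnd ℂ) a * (e * Real.tanh t)) := by
  have h : ((Real.cosh t : ℝ) : ℂ) ≠ 0 := by exact_mod_cast (Real.cosh_pos t).ne'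
  have h1 : ((Real.tanh t : ℝ) : ℂ) = Real.sinh t / Real.cosh t := by
    rw [Real.tanh_eq_sinh_div_cosh]; push_cast; rfl
  rw [geodesic, geodesicDenom, ← mul_div_mul_right (a + e * Real.tanh t) _ h, h1]
  congr 1 <;> field_simp

/-- Two distinct points of the disk are joined by a unit speed geodesic. -/
theorem exists_geodesic_eq {z₁ z₂ : ℂ} (h₁ : ‖z₁‖ < 1) (h₂ : ‖z₂‖ < 1) (hne : z₁ ≠ z₂) :
    ∃ e : ℂ, ‖e‖ = 1 ∧ geodesic z₁ e (hypDist z₁ z₂) = z₂ := by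
  have hden : 1 - (starRingEnd ℂ) z₁ * z₂ ≠ 0 := by
    simpa [sub_eq_add_neg] using one_add_conj_mul_ne_zero (a := -z₁) (by simpa using h₁) h₂
  set w := (z₂ - z₁) / (1 - (starRingEnd ℂ) z₁ * z₂) with hw
  have hwn : pseudoHypDist z₁ z₂ = ‖w‖ := by rw [pseudoHypDist, hw, ← norm_neg, ← neg_div, neg_sub]
  have hw0 : (‖w‖ : ℂ) ≠ 0 := by
    simpa [hw] using ⟨sub_ne_zero.2 hne.symm, hden⟩
  refine ⟨w / ‖w‖, ?_, ?_⟩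
  · rw [norm_div, Complex.norm_real, norm_norm, div_self (by simpa using hw0)]
  · rw [geodesic_eq_mobius, tanh_hypDist (pseudoHypDist_lt_one h₁ h₂), hwn, div_mul_cancel₀ _ hw0]
    have h3 : (1 : ℂ) - (starRingEnd ℂ) z₁ * z₁ ≠ 0 := by
      simpa [sub_eq_add_neg] using one_add_conj_mul_ne_zero (a := -z₁) (by simpa using h₁) h₁
    have hden' := mul_comm z₂ ((starRingEnd ℂ) z₁) ▸ hden
    have e1 : z₁ + w = z₂ * (1 - (starRingEnd ℂ) z₁ * z₁) / (1 - (starRingEnd ℂ) z₁ * z₂) := by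
      rw [hw]; field_simp; ring
    have e2 : 1 + (starRingEnd ℂ) z₁ * w =
        (1 - (starRingEnd ℂ) z₁ * z₁) / (1 - (starRingEnd ℂ) z₁ * z₂) := by
      rw [hw]; field_simp; ring
    rw [e1, e2, div_div_div_cancel_right₀ hden, mul_div_cancel_right₀ _ h3]

theorem hypDist_self (z : ℂ) : hypDist z z = 0 := by simp [hypDist, pseudoHypDist]

theorem twoPointDistortion_self (f : ℂ → ℂ) (z : ℂ) : twoPointDistortion f z z = 0 := by
  simp [twoPointDistortion]

namespace IsClassG

variable {β : ℝ} {f : ℂ → ℂ} {z₁ z₂ : ℂ}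

theorem sin_le_twoPointDistortion (hf : IsClassG β f) (hβ : 0 < β) {δ : ℝ} (hδ : 0 < δ)
    (hδβ : δ ^ 2 = β ^ 2 + 2 * β - 1) (h₁ : ‖z₁‖ < 1) (h₂ : ‖z₂‖ < 1)
    (h : hypDist z₁ z₂ ≤ Real.pi / δ) :
    1 / δ * Real.sin (δ * hypDist z₁ z₂) ≤ twoPointDistortion f z₁ z₂ := by
  rcases eq_or_ne z₁ z₂ with rfl | hne
  · simp [hypDist_self, twoPointDistortion_self]
  obtain ⟨e, he, hez⟩ := exists_geodesic_eq h₁ h₂ hne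
  obtain ⟨v, v', q, hv, hv', hq, h0, h0', hΔ⟩ := hf.exists_solution hβ h₁ he
  have key := sin_le_norm_of_hasDerivAt hδ hv hv' (fun t => by
    have h3 := (Complex.abs_re_le_norm (q t - 1)).trans (hq t)
    rw [Complex.sub_re, Complex.one_re] at h3
    linarith [(abs_le.1 h3).1]) h0 (hypDist_nonneg (pseudoHypDist_lt_one h₁ h₂)) h
  rw [hΔ, hez] at key
  have := le_of_mul_le_mul_left key (norm_pos_iff.2 h0')
  rwa [one_div, inv_mul_eq_div]

theorem twoPointDistortion_le_sinh (hf : IsClassG β f) (hβ : 0 < β) (h₁ : ‖z₁‖ < 1)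
    (h₂ : ‖z₂‖ < 1) :
    twoPointDistortion f z₁ z₂ ≤ 1 / (1 + β) * Real.sinh ((1 + β) * hypDist z₁ z₂) := by
  rcases eq_or_ne z₁ z₂ with rfl | hne
  · simp [hypDist_self, twoPointDistortion_self]
  obtain ⟨e, he, hez⟩ := exists_geodesic_eq h₁ h₂ hne
  obtain ⟨v, v', q, hv, hv', hq, h0, h0', hΔ⟩ := hf.exists_solution hβ h₁ he
  have key := norm_le_sinh_of_hasDerivAt (k := 1 + β) (by linarith) hv hv' (fun t => by
    have h3 := norm_add_le (q t - 1) 1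
    rw [sub_add_cancel, norm_one] at h3
    linarith [hq t]) h0 (hypDist_nonneg (pseudoHypDist_lt_one h₁ h₂))
  rw [hΔ, hez] at key
  have := le_of_mul_le_mul_left key (norm_pos_iff.2 h0')
  rwa [one_div, inv_mul_eq_div]

end IsClassG

/-! ### The extremal function and sharpness of the upper bound -/

/-- The extremal function, normalized by `f' z = (1 - z) ^ β`. -/
noncomputable def extremalG (β : ℝ) (z : ℂ) : ℂ :=
  (1 - (1 - z) ^ ((1 + β : ℝ) : ℂ)) / ((1 + β : ℝ) : ℂ)

theorem one_sub_mem_slitPlane {z : ℂ} (hz : z ∈ ball (0 : ℂ) 1) : 1 - z ∈ Complex.slitPlane := by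
  left
  have := (Complex.re_le_norm z).trans_lt (mem_ball_zero_iff.1 hz)
  simpa using this

section Extremal

variable {β : ℝ}

theorem hasDerivAt_extremalG (hβ : 0 < β) {z : ℂ} (hz : z ∈ ball (0 : ℂ) 1) :
    HasDerivAt (extremalG β) ((1 - z) ^ (β : ℂ)) z := by
  have h0 : ((1 + β : ℝ) : ℂ) ≠ 0 := by exact_mod_cast (by linarith : (1 + β : ℝ) ≠ 0)
  refine (((((hasDerivAt_id z).const_sub 1).cpow_const
    (one_sub_mem_slitPlane hz)).const_sub 1).div_const _).congr_deriv ?_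
  rw [show ((1 + β : ℝ) : ℂ) - 1 = β by push_cast; ring]
  simp only [id]
  field_simp

theorem deriv_deriv_extremalG (hβ : 0 < β) {z : ℂ} (hz : z ∈ ball (0 : ℂ) 1) :
    deriv (deriv (extremalG β)) z = -(β * (1 - z) ^ ((β : ℂ) - 1)) := by
  have h1 : deriv (extremalG β) =ᶠ[𝓝 z] fun z => (1 - z) ^ (β : ℂ) := by
    filter_upwards [isOpen_ball.mem_nhds hz] with w hw
    exact (hasDerivAt_extremalG hβ hw).deriv
  rw [h1.deriv_eq, (((hasDerivAt_id' z).const_sub 1).cpow_const (one_sub_mem_slitPlane hz)).deriv]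
  simp

/-- For the extremal function `z f''/f' = -β z/(1 - z)`, so this is exactly membership in the class.
-/
theorem neg_half_lt_re_div_one_sub {z : ℂ} (hz : ‖z‖ < 1) : -(1 / 2) < (z / (1 - z)).re := by
  have h0 : 1 - z ≠ 0 :=
    Complex.slitPlane_ne_zero (one_sub_mem_slitPlane (mem_ball_zero_iff.2 hz))
  have h1 : 0 < Complex.normSq (1 - z) := Complex.normSq_pos.2 h0
  have h2 : ‖z‖ ^ 2 < 1 := by nlinarith [norm_nonneg z]
  rw [Complex.sq_norm, Complex.normSq_apply] at h2
  rw [Complex.div_re, ← add_div, lt_div_iff₀ h1, Complex.normSq_apply]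
  simp only [Complex.sub_re, Complex.sub_im, Complex.one_re, Complex.one_im]
  nlinarith

theorem isClassG_extremalG (hβ : 0 < β) : IsClassG β (extremalG β) where
  analytic z hz := (hasDerivAt_extremalG hβ hz).differentiableAt.differentiableWithinAt
  map_zero := by simp [extremalG]
  deriv_zero := by
    rw [(hasDerivAt_extremalG hβ (mem_ball_self one_pos)).deriv]; simp
  deriv_ne_zero z hz := by
    have := Complex.slitPlane_ne_zero (one_sub_mem_slitPlane hz)
    rw [(hasDerivAt_extremalG hβ hz).deriv]
    simp [Complex.cpow_eq_zero_iff, this]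
  re_lt z hz := by
    have h0 := Complex.slitPlane_ne_zero (one_sub_mem_slitPlane hz)
    have h1 : (1 - z) ^ (β : ℂ) ≠ 0 := by simp [Complex.cpow_eq_zero_iff, h0]
    rw [(hasDerivAt_extremalG hβ hz).deriv, deriv_deriv_extremalG hβ hz,
      Complex.cpow_sub _ _ h0, Complex.cpow_one]
    have h2 : z * -(β * ((1 - z) ^ (β : ℂ) / (1 - z))) / (1 - z) ^ (β : ℂ) =
        ((-β : ℝ) : ℂ) * (z / (1 - z)) := by push_cast; field_simp
    rw [h2, Complex.add_re, Complex.re_ofReal_mul, Complex.one_re]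
    nlinarith [neg_half_lt_re_div_one_sub (mem_ball_zero_iff.1 hz)]

theorem one_sub_norm_one_sub_sq (s : ℝ) (α : ℂ) :
    1 - ‖1 - s * α‖ ^ 2 = s * (2 * α.re - s * ‖α‖ ^ 2) := by
  simp only [Complex.sq_norm, Complex.normSq_apply, Complex.sub_re, Complex.sub_im, Complex.mul_re,
    Complex.mul_im, Complex.one_re, Complex.one_im, Complex.ofReal_re, Complex.ofReal_im]
  ring

/-- A positive factor leaves the principal argument unchanged. This homogeneity lets the powers of
`s` cancel in the rescaled distortion. -/
theorem ofReal_mul_cpow {s : ℝ} (hs : 0 < s) {α : ℂ} (hα : α ≠ 0) (k : ℝ) :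
    ((s : ℂ) * α) ^ (k : ℂ) = ((s ^ k : ℝ) : ℂ) * α ^ (k : ℂ) := by
  have hs' : (s : ℂ) ≠ 0 := by exact_mod_cast hs.ne'
  rw [Complex.ofReal_cpow hs.le, Complex.cpow_def_of_ne_zero (mul_ne_zero hs' hα),
    Complex.cpow_def_of_ne_zero hs', Complex.cpow_def_of_ne_zero hα, ← Complex.exp_add,
    Complex.log_ofReal_mul hs hα, ← Complex.ofReal_log hs.le, add_mul]

/-- The two-point distortion of the extremal function, rescaled at the boundary point `1`. -/
theorem twoPointDistortion_extremalG (hβ : 0 < β) {s : ℝ} (hs : 0 < s) {α α' : ℂ} (hα : α ≠ 0)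
    (hα' : α' ≠ 0) (h : ‖1 - s * α‖ < 1) (h' : ‖1 - s * α'‖ < 1) :
    twoPointDistortion (extremalG β) (1 - s * α) (1 - s * α') =
      ‖α ^ ((1 + β : ℝ) : ℂ) - α' ^ ((1 + β : ℝ) : ℂ)‖ / ((1 + β) *
        √(((2 * α.re - s * ‖α‖ ^ 2) * ‖α‖ ^ β) * ((2 * α'.re - s * ‖α'‖ ^ 2) * ‖α'‖ ^ β))) := by
  have hsk : 0 < s ^ (1 + β) := Real.rpow_pos_of_pos hs _
  have hnum : ‖extremalG β (1 - s * α) - extremalG β (1 - s * α')‖ =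
      s ^ (1 + β) * ‖α ^ ((1 + β : ℝ) : ℂ) - α' ^ ((1 + β : ℝ) : ℂ)‖ / (1 + β) := by
    have e : extremalG β (1 - s * α) - extremalG β (1 - s * α') =
        -(((s ^ (1 + β) : ℝ) : ℂ) * (α ^ ((1 + β : ℝ) : ℂ) - α' ^ ((1 + β : ℝ) : ℂ)) /
          ((1 + β : ℝ) : ℂ)) := by
      simp only [extremalG, sub_sub_cancel]
      rw [ofReal_mul_cpow hs hα, ofReal_mul_cpow hs hα']
      ring
    rw [e, norm_neg, norm_div, norm_mul, Complex.norm_of_nonneg hsk.le,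
      Complex.norm_of_nonneg (by linarith)]
  have hden : ∀ {α : ℂ}, ‖1 - s * α‖ < 1 →
      (1 - ‖1 - s * α‖ ^ 2) * ‖deriv (extremalG β) (1 - s * α)‖ =
      s ^ (1 + β) * ((2 * α.re - s * ‖α‖ ^ 2) * ‖α‖ ^ β) := by
    intro α h
    rw [(hasDerivAt_extremalG hβ (mem_ball_zero_iff.2 h)).deriv, sub_sub_cancel,
      Complex.norm_cpow_real, norm_mul, Complex.norm_of_nonneg hs.le,
      Real.mul_rpow hs.le (norm_nonneg _), one_sub_norm_one_sub_sq, Real.rpow_add hs,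
      Real.rpow_one]
    ring
  rw [twoPointDistortion, hnum, hden h, hden h', mul_mul_mul_comm, Real.sqrt_mul (by positivity),
    Real.sqrt_mul_self hsk.le]
  rw [div_div, mul_left_comm, mul_div_mul_left _ _ hsk.ne']

/-- As `s → 0` this becomes the pseudo-hyperbolic distance of the right half-plane. -/
theorem pseudoHypDist_one_sub {s : ℝ} (hs : 0 < s) (α α' : ℂ) :
    pseudoHypDist (1 - s * α) (1 - s * α') =
      ‖α' - α‖ / ‖(starRingEnd ℂ) α + α' - s * ((starRingEnd ℂ) α * α')‖ := by
  have hs' : (s : ℂ) ≠ 0 := by exact_mod_cast hs.ne'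
  rw [pseudoHypDist, ← norm_div, ← mul_div_mul_left (α' - α) _ hs']
  congr 2
  · ring
  · simp only [map_sub, map_mul, map_one, Complex.conj_ofReal]; ring

variable {α α' : ℝ → ℂ} {A A' : ℂ}

theorem eventually_norm_one_sub_lt_one (hα : Tendsto α (𝓝[>] 0) (𝓝 A)) (hA : 0 < A.re) :
    ∀ᶠ s : ℝ in 𝓝[>] 0, ‖1 - s * α s‖ < 1 := by
  have hs : Tendsto (fun s : ℝ => s) (𝓝[>] 0) (𝓝 0) := nhdsWithin_le_nhds
  have h1 : Tendsto (fun s : ℝ => 2 * (α s).re - s * ‖α s‖ ^ 2) (𝓝[>] 0)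
      (𝓝 (2 * A.re - 0 * ‖A‖ ^ 2)) :=
    (((Complex.continuous_re.tendsto A).comp hα).const_mul 2).sub (hs.mul (hα.norm.pow 2))
  filter_upwards [h1.eventually (lt_mem_nhds (by simpa using hA : (0 : ℝ) < _)),
    self_mem_nhdsWithin] with s h2 h3
  have h4 : 0 < 1 - ‖1 - s * α s‖ ^ 2 := by
    rw [one_sub_norm_one_sub_sq]; exact mul_pos h3 h2
  nlinarith [norm_nonneg (1 - s * α s)]

/-- The limit is the distortion of `w^(1 + β)/(1 + β)` on the right half-plane. The points may vary
with `s`, so that their distance can be held fixed. -/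
theorem tendsto_twoPointDistortion_extremalG (hβ : 0 < β) (hα : Tendsto α (𝓝[>] 0) (𝓝 A))
    (hα' : Tendsto α' (𝓝[>] 0) (𝓝 A')) (hA : 0 < A.re) (hA' : 0 < A'.re) :
    Tendsto (fun s : ℝ => twoPointDistortion (extremalG β) (1 - s * α s) (1 - s * α' s)) (𝓝[>] 0)
      (𝓝 (‖A ^ ((1 + β : ℝ) : ℂ) - A' ^ ((1 + β : ℝ) : ℂ)‖ / ((1 + β) *
        √((2 * A.re * ‖A‖ ^ β) * (2 * A'.re * ‖A'‖ ^ β))))) := by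
  have hs : Tendsto (fun s : ℝ => s) (𝓝[>] 0) (𝓝 0) := nhdsWithin_le_nhds
  have hA0 : A ≠ 0 := by rintro rfl; simp at hA
  have hA0' : A' ≠ 0 := by rintro rfl; simp at hA'
  have hfac : ∀ {α : ℝ → ℂ} {A : ℂ}, Tendsto α (𝓝[>] 0) (𝓝 A) → A ≠ 0 →
      Tendsto (fun s : ℝ => (2 * (α s).re - s * ‖α s‖ ^ 2) * ‖α s‖ ^ β) (𝓝[>] 0)
        (𝓝 (2 * A.re * ‖A‖ ^ β)) := by
    intro α A hα hA0
    have := ((((Complex.continuous_re.tendsto A).comp hα).const_mul 2).sub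
      (hs.mul (hα.norm.pow 2))).mul (hα.norm.rpow_const (p := β) (Or.inl (norm_ne_zero_iff.2 hA0)))
    simpa using this
  have hpow : ∀ {α : ℝ → ℂ} {A : ℂ}, Tendsto α (𝓝[>] 0) (𝓝 A) → 0 < A.re →
      Tendsto (fun s : ℝ => α s ^ ((1 + β : ℝ) : ℂ)) (𝓝[>] 0) (𝓝 (A ^ ((1 + β : ℝ) : ℂ))) :=
    fun hα hA => Filter.Tendsto.cpow hα tendsto_const_nhds (Or.inl hA)
  have hlim := ((hpow hα hA).sub (hpow hα' hA')).norm.div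
    ((((hfac hα hA0).mul (hfac hα' hA0')).sqrt).const_mul (1 + β)) (by
      have := norm_pos_iff.2 hA0
      have := norm_pos_iff.2 hA0'
      positivity)
  refine hlim.congr' ?_
  filter_upwards [eventually_norm_one_sub_lt_one hα hA, eventually_norm_one_sub_lt_one hα' hA',
    self_mem_nhdsWithin, hα.eventually_ne hA0, hα'.eventually_ne hA0'] with s h1 h2 h3 h4 h5
  exact (twoPointDistortion_extremalG hβ h3 h4 h5 h1 h2).symm

/-- Along pairs of real points tending to `1` at constant distance `l`, the upper bound is
approached. -/
theorem exists_hypDist_eq_and_lt_twoPointDistortion (hβ : 0 < β) {l ε : ℝ} (hl : 0 < l)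
    (hε : 0 < ε) : ∃ z₁ ∈ ball (0 : ℂ) 1, ∃ z₂ ∈ ball (0 : ℂ) 1, hypDist z₁ z₂ = l ∧
      1 / (1 + β) * Real.sinh ((1 + β) * l) - ε < twoPointDistortion (extremalG β) z₁ z₂ := by
  -- The map `α ↦ 1/α - s/2` carries the disk `‖1 - s α‖ < 1` isometrically onto the right
  -- half-plane. The points used are the preimages of `exp (∓l)`, hence at distance exactly `l` for
  -- every `s`.
  set c : ℝ → ℝ → ℂ := fun l s => ((1 / (Real.exp (-l) + s / 2) : ℝ) : ℂ) with hc
  have hlim : ∀ l : ℝ, Tendsto (c l) (𝓝[>] 0) (𝓝 ((Real.exp l : ℝ) : ℂ)) := by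
    intro l
    have h1 : ContinuousAt (fun s : ℝ => 1 / (Real.exp (-l) + s / 2)) 0 := by
      refine ContinuousAt.div (by fun_prop) (by fun_prop) ?_
      simp
    have h2 := (Complex.continuous_ofReal.tendsto _).comp
      (h1.tendsto.mono_left (nhdsWithin_le_nhds (s := Ioi 0)))
    simpa [hc, Real.exp_neg, Function.comp_def] using h2
  have hpos : ∀ l : ℝ, 0 < ((Real.exp l : ℝ) : ℂ).re := fun l => by
    rw [Complex.ofReal_re]; exact Real.exp_pos l
  have hT := tendsto_twoPointDistortion_extremalG hβ (hlim l) (hlim (-l)) (hpos l) (hpos (-l))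
  have hval : ‖((Real.exp l : ℝ) : ℂ) ^ ((1 + β : ℝ) : ℂ) -
      ((Real.exp (-l) : ℝ) : ℂ) ^ ((1 + β : ℝ) : ℂ)‖ / ((1 + β) *
        √((2 * ((Real.exp l : ℝ) : ℂ).re * ‖((Real.exp l : ℝ) : ℂ)‖ ^ β) *
          (2 * ((Real.exp (-l) : ℝ) : ℂ).re * ‖((Real.exp (-l) : ℝ) : ℂ)‖ ^ β))) =
      1 / (1 + β) * Real.sinh ((1 + β) * l) := by
    have hkl : 0 < (1 + β) * l := by positivity
    have e1 : Real.exp l ^ β * Real.exp (-l) ^ β = 1 := by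
      rw [← Real.mul_rpow (Real.exp_pos _).le (Real.exp_pos _).le, ← Real.exp_add]; simp
    have e2 : Real.exp l * Real.exp (-l) = 1 := by rw [← Real.exp_add]; simp
    rw [← Complex.ofReal_cpow (Real.exp_pos _).le, ← Complex.ofReal_cpow (Real.exp_pos _).le,
      ← Complex.ofReal_sub, Complex.norm_of_nonneg, Complex.norm_of_nonneg (Real.exp_pos _).le,
      Complex.norm_of_nonneg (Real.exp_pos _).le, Complex.ofReal_re, Complex.ofReal_re,
      show (2 * Real.exp l * Real.exp l ^ β) * (2 * Real.exp (-l) * Real.exp (-l) ^ β) =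
        2 ^ 2 by linear_combination 4 * Real.exp l * Real.exp (-l) * e1 + 4 * e2,
      Real.sqrt_sq (by norm_num), ← Real.exp_mul, ← Real.exp_mul, Real.sinh_eq]
    · rw [show -l * (1 + β) = -((1 + β) * l) by ring, mul_comm l]
      field_simp
    · rw [← Real.exp_mul, ← Real.exp_mul, sub_nonneg, Real.exp_le_exp]
      nlinarith
  rw [hval] at hT
  obtain ⟨s, h1, h2, h3, h4⟩ := ((hT.eventually (lt_mem_nhds (sub_lt_self _ hε))).and
    ((eventually_norm_one_sub_lt_one (hlim l) (hpos l)).and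
    ((eventually_norm_one_sub_lt_one (hlim (-l)) (hpos (-l))).and self_mem_nhdsWithin))).exists
  have hs : (0 : ℝ) < s := h4
  refine ⟨_, mem_ball_zero_iff.2 h2, _, mem_ball_zero_iff.2 h3, ?_, h1⟩
  rw [hypDist_eq_artanh (pseudoHypDist_lt_one h2 h3), ← Real.artanh_tanh l]
  congr 1
  rw [pseudoHypDist_one_sub hs]
  have hp := Real.exp_pos l
  have hq := Real.exp_pos (-l)
  have hpq : Real.exp l * Real.exp (-l) = 1 := by rw [← Real.exp_add]; simp
  have hlt : Real.exp (-l) < Real.exp l := Real.exp_lt_exp.2 (by linarith)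
  simp only [hc, Complex.conj_ofReal, neg_neg, Real.artanh_tanh]
  rw [← Complex.ofReal_add, ← Complex.ofReal_mul, ← Complex.ofReal_mul, ← Complex.ofReal_sub,
    ← Complex.ofReal_sub, Complex.norm_real, Complex.norm_real, Real.tanh_eq_sinh_div_cosh,
    Real.sinh_eq, Real.cosh_eq]
  generalize Real.exp l = p at *
  generalize Real.exp (-l) = q at *
  have e1 : 1 / (p + s / 2) - 1 / (q + s / 2) = -((p - q) / ((p + s / 2) * (q + s / 2))) := by
    field_simp; ring
  have e2 : 1 / (q + s / 2) + 1 / (p + s / 2) - s * (1 / (q + s / 2) * (1 / (p + s / 2))) =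
      (p + q) / ((p + s / 2) * (q + s / 2)) := by
    field_simp; ring
  rw [e1, e2, norm_neg, Real.norm_of_nonneg (div_nonneg (by linarith) (by positivity)),
    Real.norm_of_nonneg (by positivity)]
  field_simp

/-- Chords from the origin of the strictly convex `sinh` have increasing slope. -/
theorem sinh_div_lt_sinh_div {c k : ℝ} (hc : 0 < c) (hck : c < k) :
    Real.sinh c / c < Real.sinh k / k := by
  have hconv : StrictConvexOn ℝ (Ici (0 : ℝ)) Real.sinh := by
    refine strictConvexOn_of_deriv2_pos (convex_Ici 0) Real.continuous_sinh.continuousOn ?_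
    intro x hx
    rw [interior_Ici] at hx
    simpa using Real.sinh_pos_iff.2 hx
  have hk := hc.trans hck
  have h1 : c / k < 1 := (div_lt_one hk).2 hck
  have := hconv.2 (x := 0) self_mem_Ici (y := k) hk.le hk.ne (sub_pos.2 h1) (div_pos hc hk)
    (sub_add_cancel _ _)
  simp only [smul_eq_mul, mul_zero, zero_add, Real.sinh_zero, div_mul_cancel₀ _ hk.ne'] at this
  rw [div_lt_iff₀ hc]
  calc _ < _ := this
    _ = _ := by ring

end Extremal

/-! ### Sharpness of the lower bound -/

/-- A function vanishing to second order at `0`, with negative third derivative there,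
is negative to the right of `0`. -/
theorem eventually_neg_of_hasDerivAt {D D₁ D₂ : ℝ → ℝ} {d : ℝ}
    (h₁ : ∀ t, HasDerivAt D (D₁ t) t) (h₂ : ∀ t, HasDerivAt D₁ (D₂ t) t) (h₃ : HasDerivAt D₂ d 0)
    (hd : d < 0) (e₀ : D 0 = 0) (e₁ : D₁ 0 = 0) (e₂ : D₂ 0 = 0) : ∀ᶠ t in 𝓝[>] 0, D t < 0 := by
  have hneg : ∀ {F F' : ℝ → ℝ} {r : ℝ}, (∀ t, HasDerivAt F (F' t) t) → F 0 = 0 →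
      (∀ t ∈ Ioo 0 r, F' t < 0) → ∀ t ∈ Ioo 0 r, F t < 0 := by
    intro F F' r hF hF0 hF' t ht
    have anti : StrictAntiOn F (Icc 0 t) := by
      refine strictAntiOn_of_deriv_neg (convex_Icc 0 t)
        (fun x _ => (hF x).continuousAt.continuousWithinAt) fun x hx => ?_
      rw [interior_Icc] at hx
      rw [(hF x).deriv]
      exact hF' x ⟨hx.1, hx.2.trans ht.2⟩
    simpa [hF0] using anti ⟨le_rfl, ht.1.le⟩ ⟨ht.1.le, le_rfl⟩ ht.1
  have hD₂ : ∀ᶠ t in 𝓝[>] (0 : ℝ), D₂ t < 0 := by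
    have h := h₃.tendsto_slope_zero_right
    filter_upwards [h.eventually (gt_mem_nhds hd), self_mem_nhdsWithin] with t ht ht0
    have ht0 : (0 : ℝ) < t := ht0
    rw [zero_add, e₂, sub_zero, smul_eq_mul] at ht
    exact neg_of_mul_neg_right ht (inv_nonneg.2 ht0.le)
  obtain ⟨r, hr, hr'⟩ := mem_nhdsGT_iff_exists_Ioo_subset.1 hD₂
  exact mem_nhdsGT_iff_exists_Ioo_subset.2
    ⟨r, hr, hneg h₁ e₀ (hneg h₂ e₁ fun t ht => hr' ht)⟩

/-- The limiting distortion profile of the extremal function along geodesics orthogonal to the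
real axis, near the boundary point `1`, lies below `sin (δ t) / δ` for small `t`, if `δ² < k² - 2`. -/
theorem eventually_sin_mul_cosh_lt {k δ : ℝ} (hk : 0 < k) (hδ : 0 < δ) (hkδ : δ ^ 2 < k ^ 2 - 2) :
    ∀ᶠ t in 𝓝[>] (0 : ℝ), Real.sin (k * Real.arctan (Real.sinh t)) * Real.cosh t / k <
      1 / δ * Real.sin (δ * t) := by
  have hθ : ∀ t, HasDerivAt (fun t => k * Real.arctan (Real.sinh t)) (k * (1 / Real.cosh t)) t := by
    intro t
    refine ((Real.hasDerivAt_sinh t).arctan.const_mul k).congr_deriv ?_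
    have := (Real.cosh_pos t).ne'
    rw [add_comm, ← Real.cosh_sq]
    field_simp
  have hδt : ∀ t : ℝ, HasDerivAt (fun t => δ * t) δ t := fun t => by
    simpa using (hasDerivAt_id t).const_mul δ
  have h := eventually_neg_of_hasDerivAt
    (D := fun t => Real.sin (k * Real.arctan (Real.sinh t)) * Real.cosh t / k -
      1 / δ * Real.sin (δ * t))
    (D₁ := fun t => Real.cos (k * Real.arctan (Real.sinh t)) +
      Real.sin (k * Real.arctan (Real.sinh t)) * Real.sinh t / k - Real.cos (δ * t))
    (D₂ := fun t => -Real.sin (k * Real.arctan (Real.sinh t)) * (k * (1 / Real.cosh t)) +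
      (Real.cos (k * Real.arctan (Real.sinh t)) * (1 / Real.cosh t) * Real.sinh t +
        Real.sin (k * Real.arctan (Real.sinh t)) * Real.cosh t / k) + δ * Real.sin (δ * t))
    -- The third derivative at `0`. With `k = 1 + β` it is `δ² - δ_β²`, the source of the sharp
    -- constant.
    (d := 2 - k ^ 2 + δ ^ 2)
    (fun t => by
      refine ((((hθ t).sin.mul (Real.hasDerivAt_cosh t)).div_const k).sub
        ((hδt t).sin.const_mul (1 / δ))).congr_deriv ?_
      have := (Real.cosh_pos t).ne'
      field_simp)
    (fun t => by
      refine (((hθ t).cos.add (((hθ t).sin.mul (Real.hasDerivAt_sinh t)).div_const k)).sub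
        (hδt t).cos).congr_deriv ?_
      have := (Real.cosh_pos t).ne'
      field_simp
      ring)
    (by
      have hinv : HasDerivAt (fun t => 1 / Real.cosh t)
          ((0 * Real.cosh 0 - 1 * Real.sinh 0) / Real.cosh 0 ^ 2) 0 :=
        (hasDerivAt_const 0 1).div (Real.hasDerivAt_cosh 0) (Real.cosh_pos 0).ne'
      refine ((((hθ 0).sin.neg.mul (hinv.const_mul k)).add
        ((((hθ 0).cos.mul hinv).mul (Real.hasDerivAt_sinh 0)).add
          (((hθ 0).sin.mul (Real.hasDerivAt_cosh 0)).div_const k))).add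
        ((hδt 0).sin.const_mul δ)).congr_deriv ?_
      simp
      field_simp
      ring)
    (by linarith) (by simp) (by simp) (by simp)
  filter_upwards [h] with t ht
  linarith

theorem cos_arctan_sinh (t : ℝ) : Real.cos (Real.arctan (Real.sinh t)) = 1 / Real.cosh t := by
  rw [Real.cos_arctan, add_comm, ← Real.cosh_sq, Real.sqrt_sq (Real.cosh_pos t).le]

theorem sin_arctan_sinh (t : ℝ) : Real.sin (Real.arctan (Real.sinh t)) = Real.tanh t := by
  rw [Real.sin_arctan, add_comm, ← Real.cosh_sq, Real.sqrt_sq (Real.cosh_pos t).le,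
    Real.tanh_eq_sinh_div_cosh]

/-- Blow up at `1` along the conjugate pair `exp (± iθ)` with `tan θ = sinh t`: the limiting
distance is `t` and the limiting distortion is the profile of `eventually_sin_mul_cosh_lt`. The
strict inequality survives for small `s`. -/
theorem exists_twoPointDistortion_lt_sin {β δ L : ℝ} (hβ : 0 < β) (hδ : 0 < δ)
    (hδβ : δ ^ 2 < β ^ 2 + 2 * β - 1) (hL : 0 < L) :
    ∃ z₁ ∈ ball (0 : ℂ) 1, ∃ z₂ ∈ ball (0 : ℂ) 1, hypDist z₁ z₂ ≤ L ∧
      twoPointDistortion (extremalG β) z₁ z₂ < 1 / δ * Real.sin (δ * hypDist z₁ z₂) := by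
  have hk : 0 < 1 + β := by linarith
  -- This keeps `sin ((1 + β) θ)` nonnegative, so that it equals its modulus.
  have hsmall : ∀ᶠ t in 𝓝[>] (0 : ℝ), |(1 + β) * Real.arctan (Real.sinh t)| < Real.pi := by
    have hc : Continuous fun t => |(1 + β) * Real.arctan (Real.sinh t)| := by
      have := Real.continuous_sinh
      fun_prop
    refine ((hc.tendsto 0).mono_left nhdsWithin_le_nhds).eventually (gt_mem_nhds ?_)
    simpa using Real.pi_pos
  obtain ⟨t, ht, htπ, ht0, htL⟩ := ((eventually_sin_mul_cosh_lt hk hδ (by nlinarith)).and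
    (hsmall.and (Ioo_mem_nhdsGT hL))).exists
  set θ := Real.arctan (Real.sinh t) with hθ
  have hθ0 : 0 < θ := by
    rw [hθ, ← Real.arctan_zero]; exact Real.arctan_strictMono (Real.sinh_pos_iff.2 ht0)
  have hc := Real.cosh_pos t
  set A : ℂ := Complex.exp (θ * Complex.I) with hA
  have hAre : A.re = 1 / Real.cosh t := by
    rw [hA, Complex.exp_ofReal_mul_I_re, cos_arctan_sinh]
  have hAim : A.im = Real.tanh t := by
    rw [hA, Complex.exp_ofReal_mul_I_im, sin_arctan_sinh]
  have hAn : ‖A‖ = 1 := Complex.norm_exp_ofReal_mul_I θ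
  have hpos : 0 < A.re := by rw [hAre]; positivity
  have hpos' : 0 < ((starRingEnd ℂ) A).re := by rwa [Complex.conj_re]
  have hpow : A ^ ((1 + β : ℝ) : ℂ) = Complex.exp (((1 + β) * θ : ℝ) * Complex.I) := by
    rw [Complex.cpow_def_of_ne_zero (Complex.exp_ne_zero _), Complex.log_exp]
    · congr 1; push_cast; ring
    · simpa using (neg_lt_zero.2 Real.pi_pos).trans hθ0
    · have := Real.arctan_lt_pi_div_two (Real.sinh t)
      simp only [Complex.mul_im, Complex.ofReal_re, Complex.I_im, mul_one, Complex.ofReal_im,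
        Complex.I_re, mul_zero, add_zero]
      linarith [Real.pi_pos]
  have hpow' : ((starRingEnd ℂ) A) ^ ((1 + β : ℝ) : ℂ) =
      (starRingEnd ℂ) (A ^ ((1 + β : ℝ) : ℂ)) := by
    rw [Complex.conj_cpow _ _ ?_, Complex.conj_ofReal]
    rw [Ne, Complex.arg_eq_pi_iff]
    exact fun h => hpos.not_gt h.1
  have hval : ‖A ^ ((1 + β : ℝ) : ℂ) - ((starRingEnd ℂ) A) ^ ((1 + β : ℝ) : ℂ)‖ / ((1 + β) *
        √((2 * A.re * ‖A‖ ^ β) * (2 * ((starRingEnd ℂ) A).re * ‖(starRingEnd ℂ) A‖ ^ β))) =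
      Real.sin ((1 + β) * θ) * Real.cosh t / (1 + β) := by
    have hsin : 0 ≤ Real.sin ((1 + β) * θ) :=
      Real.sin_nonneg_of_nonneg_of_le_pi (by positivity) ((le_abs_self _).trans htπ.le)
    rw [hpow', Complex.sub_conj, hpow, Complex.exp_ofReal_mul_I_im, RCLike.norm_conj,
      Complex.conj_re, hAn, hAre, Real.one_rpow, mul_one, Real.sqrt_mul_self (by positivity),
      norm_mul, Complex.norm_I, mul_one, Complex.norm_of_nonneg (by positivity)]
    field_simp
  have hconst : Tendsto (fun _ : ℝ => A) (𝓝[>] 0) (𝓝 A) := tendsto_const_nhds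
  have hconst' : Tendsto (fun _ : ℝ => (starRingEnd ℂ) A) (𝓝[>] 0) (𝓝 ((starRingEnd ℂ) A)) :=
    tendsto_const_nhds
  have hΔ := tendsto_twoPointDistortion_extremalG hβ hconst hconst' hpos hpos'
  rw [hval] at hΔ
  have hρ : Tendsto (fun s : ℝ => pseudoHypDist (1 - s * A) (1 - s * (starRingEnd ℂ) A)) (𝓝[>] 0)
      (𝓝 (Real.tanh t)) := by
    have hcont : ContinuousAt (fun s : ℝ => ‖(starRingEnd ℂ) A - A‖ /
        ‖(starRingEnd ℂ) A + (starRingEnd ℂ) A -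
          s * ((starRingEnd ℂ) A * (starRingEnd ℂ) A)‖) 0 := by
      refine ContinuousAt.div (by fun_prop) (by fun_prop) ?_
      have : (starRingEnd ℂ) A ≠ 0 := by rw [Ne, map_eq_zero]; exact Complex.exp_ne_zero _
      simpa [← two_mul] using this
    have htanh : 0 ≤ Real.tanh t := by
      rw [Real.tanh_eq_sinh_div_cosh]; exact div_nonneg (Real.sinh_nonneg_iff.2 ht0.le) hc.le
    have hv : ‖(starRingEnd ℂ) A - A‖ / ‖(starRingEnd ℂ) A + (starRingEnd ℂ) A -
          ((0 : ℝ) : ℂ) * ((starRingEnd ℂ) A * (starRingEnd ℂ) A)‖ = Real.tanh t := by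
      rw [norm_sub_rev, Complex.sub_conj, hAim, Complex.ofReal_zero, zero_mul, sub_zero, ← two_mul,
        norm_mul, norm_mul, RCLike.norm_conj, hAn, Complex.norm_I,
        Complex.norm_of_nonneg (by positivity), Complex.norm_two]
      ring
    have hlim := hcont.tendsto.mono_left (nhdsWithin_le_nhds (s := Ioi 0))
    rw [hv] at hlim
    refine hlim.congr' ?_
    filter_upwards [self_mem_nhdsWithin] with s hs
    exact (pseudoHypDist_one_sub hs _ _).symm
  have hdist : Tendsto (fun s : ℝ => hypDist (1 - s * A) (1 - s * (starRingEnd ℂ) A)) (𝓝[>] 0)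
      (𝓝 t) := by
    have h1 := Real.tanh_lt_one t
    have h2 := Real.neg_one_lt_tanh t
    have hlim := (((hρ.const_add 1).div (hρ.const_sub 1) (by linarith)).log
      (div_pos (by linarith) (by linarith)).ne').const_mul (1 / 2)
    rwa [← Real.artanh_eq_half_log ⟨h2.le, h1.le⟩, Real.artanh_tanh] at hlim
  have hfin := ((Real.continuous_sin.tendsto _).comp (hdist.const_mul δ)).const_mul (1 / δ)
  obtain ⟨s, h1, h2, h3, h4⟩ := ((hΔ.eventually_lt hfin ht).and
    ((hdist.eventually (gt_mem_nhds htL)).and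
    ((eventually_norm_one_sub_lt_one hconst hpos).and
    (eventually_norm_one_sub_lt_one hconst' hpos')))).exists
  exact ⟨_, mem_ball_zero_iff.2 h3, _, mem_ball_zero_iff.2 h4, h2.le, h1⟩

/-! ### The main theorem -/

theorem mainTheorem5 (β : ℝ) (hβ : Real.sqrt 2 - 1 < β) :
    -- the two bounds
    (∀ f : ℂ → ℂ, IsClassG β f →
      (∀ z₁ ∈ Metric.ball (0 : ℂ) 1, ∀ z₂ ∈ Metric.ball (0 : ℂ) 1,
        hypDist z₁ z₂ ≤ Real.pi / Real.sqrt (β ^ 2 + 2 * β - 1) →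
        1 / Real.sqrt (β ^ 2 + 2 * β - 1) *
            Real.sin (Real.sqrt (β ^ 2 + 2 * β - 1) * hypDist z₁ z₂)
          ≤ twoPointDistortion f z₁ z₂) ∧
      (∀ z₁ ∈ Metric.ball (0 : ℂ) 1, ∀ z₂ ∈ Metric.ball (0 : ℂ) 1,
        twoPointDistortion f z₁ z₂
          ≤ 1 / (1 + β) * Real.sinh ((1 + β) * hypDist z₁ z₂))) ∧
    -- sharpness, for one and the same function
    (∃ f : ℂ → ℂ, IsClassG β f ∧
      -- no smaller constant is possible in the lower bound, on the same range of pairs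
      (∀ δ : ℝ, 0 < δ → δ < Real.sqrt (β ^ 2 + 2 * β - 1) →
        ∃ z₁ ∈ Metric.ball (0 : ℂ) 1, ∃ z₂ ∈ Metric.ball (0 : ℂ) 1,
          hypDist z₁ z₂ ≤ Real.pi / Real.sqrt (β ^ 2 + 2 * β - 1) ∧
          twoPointDistortion f z₁ z₂ < 1 / δ * Real.sin (δ * hypDist z₁ z₂)) ∧
      -- no smaller constant is possible in the upper bound
      (∀ c : ℝ, 0 < c → c < 1 + β →
        ∃ z₁ ∈ Metric.ball (0 : ℂ) 1, ∃ z₂ ∈ Metric.ball (0 : ℂ) 1,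
          1 / c * Real.sinh (c * hypDist z₁ z₂) < twoPointDistortion f z₁ z₂) ∧
      -- the upper bound is approached at every hyperbolic distance
      (∀ l : ℝ, 0 < l → ∀ ε : ℝ, 0 < ε →
        ∃ z₁ ∈ Metric.ball (0 : ℂ) 1, ∃ z₂ ∈ Metric.ball (0 : ℂ) 1,
          hypDist z₁ z₂ = l ∧
          1 / (1 + β) * Real.sinh ((1 + β) * l) - ε < twoPointDistortion f z₁ z₂)) := by
  have h2 : 1 < √2 := Real.lt_sqrt_of_sq_lt (by norm_num)
  have hβ0 : 0 < β := by linarith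
  -- The hypothesis on `β` says `(1 + β)² > 2`.
  have hpos : 0 < β ^ 2 + 2 * β - 1 := by
    nlinarith [Real.sq_sqrt (show (0 : ℝ) ≤ 2 by norm_num)]
  have hδ : 0 < √(β ^ 2 + 2 * β - 1) := Real.sqrt_pos.2 hpos
  have hsq := Real.sq_sqrt hpos.le
  refine ⟨fun f hf => ⟨fun z₁ h₁ z₂ h₂ h => ?_, fun z₁ h₁ z₂ h₂ => ?_⟩,
    extremalG β, isClassG_extremalG hβ0, fun δ hδ0 hδlt => ?_, fun c hc hcβ => ?_,
    fun l hl ε hε => exists_hypDist_eq_and_lt_twoPointDistortion hβ0 hl hε⟩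
  · exact hf.sin_le_twoPointDistortion hβ0 hδ hsq (mem_ball_zero_iff.1 h₁)
      (mem_ball_zero_iff.1 h₂) h
  · exact hf.twoPointDistortion_le_sinh hβ0 (mem_ball_zero_iff.1 h₁) (mem_ball_zero_iff.1 h₂)
  · exact exists_twoPointDistortion_lt_sin hβ0 hδ0 (by nlinarith) (div_pos Real.pi_pos hδ)
  -- Use distance `1`, with `ε` the gap `sinh (1 + β)/(1 + β) - sinh c / c`.
  · obtain ⟨z₁, h₁, z₂, h₂, hl, hlt⟩ := exists_hypDist_eq_and_lt_twoPointDistortion hβ0 one_pos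
      (sub_pos.2 (sinh_div_lt_sinh_div hc hcβ))
    refine ⟨z₁, h₁, z₂, h₂, lt_of_eq_of_lt ?_ hlt⟩
    rw [hl, mul_one, mul_one]
    ring
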